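/- Let $\mathbb{T}^3=\mathbb{R}^3/(2\pi\mathbb{Z})^3$ and let $\mu,\kappa,\alpha,\beta,\gamma,\tau,\lambda,\nu$ be real constants with $\mu>0$, $\kappa>0$, $\alpha+\tfrac{4\beta}{3}>0$, $\beta+\gamma>0$, $\tau>0$ and $\lambda>\nu>0$. Put $d=\tfrac{\tau}{2\kappa}$, $J_{eq}=\mathrm{diag}(\lambda,\lambda,\nu)$, and for $w=(w_1,w_2)$ or $w=(w_1,w_2,w_3)$ write $\bar w^\perp=(-w_2,w_1)$ and $\tilde w^\perp=(-w_2,w_1,0)$. For $Y=(u,\omega,a):\mathbb{T}^3\to\mathbb{R}^3\times\mathbb{R}^3\times\mathbb{R}^2$ let $\mathcal{B}Y$ be the function whose three components are $$\Big(\mu+\tfrac{\kappa}{2}\Big)\Delta\,\mathbb{P}_Lu+\kappa\nabla\times\omega,$$ $$J_{eq}^{-1}\Big(\kappa\nabla\times\mathbb{P}_Lu-2\kappa\omega+\big(\alpha+\tfrac{\beta}{3}-\gamma\big)\nabla(\nabla\cdot\omega)+(\beta+\gamma)\Delta\omega-(\lambda-\nu)d\,\tilde\omega^\perp-d^2\tilde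 a^\perp\Big),$$ $$(\lambda-\nu)\bar\omega^\perp+d\,\bar a^\perp,$$ where $\mathbb{P}_L$ is the Leray projector onto divergence-free vector fields, i.e. the Fourier multiplier with symbol $P_\perp(k)$. Here $P_\parallel(k)=\frac{k\otimes k}{|k|^2}$ for $k\ne0$, $P_\parallel(0)=0$, and $P_\perp(k)=I-P_\parallel(k)$. Let $\hat{\mathcal{B}}_k\in\mathbb{C}^{8\times8}$ be the symbol of $\mathcal{B}$, that is $$\hat{\mathcal{B}}_k=\begin{pmatrix}-(\mu+\frac{\kappa}{2})|k|^2P_\perp(k)&i\kappa\,k\times&0\\ J_{eq}^{-1}(i\kappa\,k\times)P_\perp(k)&E_k&-\frac{d^2}{\lambda}R_{32}\\0&(\lambda-\nu)R_{23}&dR_{22}\end{pmatrix},$$ $$E_k=-2\kappa J_{eq}^{-1}-\big(\alpha+\tfrac{4\beta}{3}\big)|k|^2J_{eq}^{-1}P_\parallel(k)-(\beta+\gamma)|k|^2J_{eq}^{-1}P_\perp(k)-\big(1-\tfrac{\nu}{\lambda}\big)d\,R_{33},$$ where $R_{22}b=\bar b^\perp$ and $R_{32}b=\tilde b^\perp$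 for $b\in\mathbb{R}^2$, and $R_{23}w=\bar w^\perp$ and $R_{33}w=\tilde w^\perp$ for $w\in\mathbb{R}^3$. Let $M_k=Q_k\hat{\mathcal{B}}_k\bar Q_k$ with $Q_k=T(k)\oplus J_{eq}^{1/2}\oplus sR_{22}$ and $\bar Q_k=T(k)\oplus J_{eq}^{-1/2}\oplus(-s^{-1})R_{22}$, where $T(k)=\frac{ik\times}{|k|}$ for $k\neq0$, $T(0)=0$, and $s=-\frac{d}{\sqrt{\lambda-\nu}}$. Then the maximum $$\eta_*=\max\{\operatorname{Re}w:\ k\in\mathbb{Z}^3,\ w\text{ an eigenvalue of }M_k\}$$ is attained and strictly positive, and there is a smooth function $Y=(u,\omega,a):[0,\infty)\times\mathbb{T}^3\to\mathbb{R}^3\times\mathbb{R}^3\times\mathbb{R}^2$ with $Y(0,\cdot)\not\equiv0$, $\partial_tY=\mathcal{B}Y$ and $\nabla\cdot u=0$ on $[0,\infty)\times\mathbb{T}^3$, such that for every $t\ge0$ and every real $r\ge0$ the norm $\|Y(t,\cdot)\|_{H^r}$ is finite and $$\|Y(t,\cdot)\|_{H^r}=e^{\eta_*t}\|Y(0,\cdot)\|_{H^r},\qquad\|u(t,\cdot)\|_{H^r}=e^{\eta_*t}\|u(0,\cdot)\|_{H^r},$$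 $$\|\omega(t,\cdot)\|_{H^r}=e^{\eta_*t}\|\omega(0,\cdot)\|_{H^r},\qquad\|a(t,\cdot)\|_{H^r}=e^{\eta_*t}\|a(0,\cdot)\|_{H^r}.$$ Here $\|f\|_{H^r}^2=\sum_{k\in\mathbb{Z}^3}(1+|k|^2)^r|\hat f(k)|^2$, where $\hat f(k)=(2\pi)^{-3}\int_{\mathbb{T}^3}f(x)e^{-ik\cdot x}\,dx$. -/

import Mathlib

open Set MeasureTheory
open scoped Matrix ContDiff

noncomputable section

namespace Micropolar

/-! ## Physical parameters -/

/-- The physical constants: the fluid viscosities `μ, κ, α, β, γ`, the magnitude `τ` of the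
microtorque, and the eigenvalues `λ, λ, ν` of the microinertia. -/
structure Params where
  mu : ℝ
  kappa : ℝ
  alpha : ℝ
  beta : ℝ
  gamma : ℝ
  tau : ℝ
  lam : ℝ
  nu : ℝ

/-- `τ / (2κ)`, the third component of the equilibrium angular velocity. -/
def Params.rot (P : Params) : ℝ := P.tau / (2 * P.kappa)

/-- The diagonal entries of `J_eq = diag (λ, λ, ν)`. -/
def Params.inertia (P : Params) : Fin 3 → ℝ := ![P.lam, P.lam, P.nu]

/-! ## Functions on the torus `ℝ³ / (2πℤ)³`

They are represented by `2π`-periodic functions on `ℝ³`. -/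

/-- Points of `ℝ³`, and vectors in `ℝ³`. -/
abbrev V3 := Fin 3 → ℝ

/-- The index set of the eight components of `Y = (u, ω, a) ∈ ℝ³ × ℝ³ × ℝ²`. -/
abbrev Idx := Fin 3 ⊕ (Fin 3 ⊕ Fin 2)

/-- `2π`-periodicity in each of the three variables. -/
def IsPeriodic {F : Type*} (f : V3 → F) : Prop :=
  ∀ (x : V3) (j : Fin 3), f (x + Pi.single j (2 * Real.pi)) = f x

/-- The component `u` of `Y = (u, ω, a)`. -/
def uPart (Y : V3 → Idx → ℝ) : V3 → V3 := fun x i => Y x (Sum.inl i)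

/-- The component `ω` of `Y = (u, ω, a)`. -/
def omegaPart (Y : V3 → Idx → ℝ) : V3 → V3 := fun x i => Y x (Sum.inr (Sum.inl i))

/-- The component `a` of `Y = (u, ω, a)`. -/
def aPart (Y : V3 → Idx → ℝ) : V3 → Fin 2 → ℝ := fun x i => Y x (Sum.inr (Sum.inr i))

/-- The wavenumber `k ∈ ℤ³` seen as a vector in `ℝ³`. -/
def waveVec (k : Fin 3 → ℤ) : V3 := fun j => (k j : ℝ)

/-- The Fourier coefficient `(2π)⁻³ ∫ f(x) e^{-i k·x} dx`, over one period. -/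
def fourierCoef (f : V3 → ℝ) (k : Fin 3 → ℤ) : ℂ :=
  (((2 * Real.pi) ^ 3 : ℝ) : ℂ)⁻¹ *
    ∫ x in Set.Icc (0 : V3) (fun _ => 2 * Real.pi),
      (f x : ℂ) * Complex.exp (-(Complex.I * ((waveVec k ⬝ᵥ x : ℝ) : ℂ)))

/-- The term `⟨k⟩^{2r} |f̂(k)|²` of the squared `H^r` norm, where `⟨k⟩² = 1 + |k|²`. -/
def sobolevTerm {ι : Type*} [Fintype ι] (r : ℝ) (f : V3 → ι → ℝ) (k : Fin 3 → ℤ) : ℝ :=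
  (1 + waveVec k ⬝ᵥ waveVec k) ^ r * ∑ i, ‖fourierCoef (fun x => f x i) k‖ ^ 2

/-- Finiteness of the `H^r` norm. -/
def SobolevFinite {ι : Type*} [Fintype ι] (r : ℝ) (f : V3 → ι → ℝ) : Prop :=
  Summable (sobolevTerm r f)

/-- The `H^r` norm of a function on the torus with values in a Euclidean space. -/
def sobolevNorm {ι : Type*} [Fintype ι] (r : ℝ) (f : V3 → ι → ℝ) : ℝ :=
  Real.sqrt (∑' k, sobolevTerm r f k)

/-! ## Differential operators and the Leray projector -/

/-- The partial derivative `∂_j f`. -/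
def pderiv (j : Fin 3) (f : V3 → ℝ) : V3 → ℝ := fun x => fderiv ℝ f x (Pi.single j 1)

def gradient (f : V3 → ℝ) : V3 → V3 := fun x j => pderiv j f x

def divergence (v : V3 → V3) : V3 → ℝ := fun x => ∑ j, pderiv j (fun y => v y j) x

def curl (v : V3 → V3) : V3 → V3 := fun x =>
  ![pderiv 1 (fun y => v y 2) x - pderiv 2 (fun y => v y 1) x,
    pderiv 2 (fun y => v y 0) x - pderiv 0 (fun y => v y 2) x,
    pderiv 0 (fun y => v y 1) x - pderiv 1 (fun y => v y 0) x]

/-- The componentwise Laplacian. -/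
def laplacian (v : V3 → V3) : V3 → V3 := fun x i =>
  ∑ j, pderiv j (pderiv j (fun y => v y i)) x

/-- The orthogonal projection onto the span of `k` (it is `0` for `k = 0`). -/
def projPar (k : V3) : Matrix (Fin 3) (Fin 3) ℝ := (k ⬝ᵥ k)⁻¹ • Matrix.vecMulVec k k

/-- The orthogonal projection onto the orthogonal complement of `k` (the identity for `k = 0`). -/
def projPerp (k : V3) : Matrix (Fin 3) (Fin 3) ℝ := 1 - projPar k

/-- The Leray projector onto divergence-free vector fields, as the Fourier multiplier with
symbol `k ↦ projPerp k`. The sum is real when `v` is; it is absolutely convergent for smooth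
periodic `v`. -/
def leray (v : V3 → V3) : V3 → V3 := fun x i =>
  (∑' k : Fin 3 → ℤ,
    (∑ j, (projPerp (waveVec k) i j : ℂ) * fourierCoef (fun y => v y j) k) *
      Complex.exp (Complex.I * ((waveVec k ⬝ᵥ x : ℝ) : ℂ))).re

/-! ## The linearized operator -/

/-- `w ↦ w̃^⊥ = (-w₂, w₁, 0)`, which depends only on the first two components of `w`. -/
def perpTilde (w₁ w₂ : ℝ) : V3 := ![-w₂, w₁, 0]

/-- `w ↦ w̄^⊥ = (-w₂, w₁)`. -/
def perpBar (w₁ w₂ : ℝ) : Fin 2 → ℝ := ![-w₂, w₁]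

/-- The operator `M̃` acting on `(u, ω, a)`: the right-hand sides of the linearized equations for
`u` (without the pressure), for `J_eq ω` and for `a`. -/
def opM (P : Params) (u w : V3 → V3) (a : V3 → Fin 2 → ℝ) : V3 → Idx → ℝ := fun x =>
  Sum.elim
    ((P.mu + P.kappa / 2) • laplacian u x + P.kappa • curl w x)
    (Sum.elim
      (P.kappa • curl u x - (2 * P.kappa) • w x
        + (P.alpha + P.beta / 3 - P.gamma) • gradient (divergence w) x
        + (P.beta + P.gamma) • laplacian w x
        - ((P.lam - P.nu) * P.rot) • perpTilde (w x 0) (w x 1)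
        - (P.rot ^ 2) • perpTilde (a x 0) (a x 1))
      ((P.lam - P.nu) • perpBar (w x 0) (w x 1) + P.rot • perpBar (a x 0) (a x 1)))

/-- The diagonal entries of `D̄ = I₃ ⊕ J_eq ⊕ I₂`. -/
def diagD (P : Params) : Idx → ℝ :=
  Sum.elim (fun _ => 1) (Sum.elim P.inertia (fun _ => 1))

/-- The linearized operator `B = D̄⁻¹ M̃ (P_L ⊕ I₃ ⊕ I₂)`. -/
def opB (P : Params) (Y : V3 → Idx → ℝ) : V3 → Idx → ℝ := fun x i =>
  (diagD P i)⁻¹ * opM P (leray (uPart Y)) (omegaPart Y) (aPart Y) x i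

/-! ## The symbol of the linearized operator and the growth rates -/

/-- A real matrix seen as a complex one. -/
def toC {m n : Type*} (A : Matrix m n ℝ) : Matrix m n ℂ := A.map Complex.ofReal

/-- The matrix of `z ↦ k × z`. -/
def crossMat (k : V3) : Matrix (Fin 3) (Fin 3) ℝ :=
  !![0, -k 2, k 1; k 2, 0, -k 0; -k 1, k 0, 0]

def R22 : Matrix (Fin 2) (Fin 2) ℝ := !![0, -1; 1, 0]
def R23 : Matrix (Fin 2) (Fin 3) ℝ := !![0, -1, 0; 1, 0, 0]
def R32 : Matrix (Fin 3) (Fin 2) ℝ := !![0, -1; 1, 0; 0, 0]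
def R33 : Matrix (Fin 3) (Fin 3) ℝ := !![0, -1, 0; 1, 0, 0; 0, 0, 0]

/-- `J_eq⁻¹`. -/
def Jinv (P : Params) : Matrix (Fin 3) (Fin 3) ℝ := Matrix.diagonal fun i => (P.inertia i)⁻¹

/-- `J_eq^{1/2}`. -/
def Jsqrt (P : Params) : Matrix (Fin 3) (Fin 3) ℝ :=
  Matrix.diagonal fun i => Real.sqrt (P.inertia i)

/-- `J_eq^{-1/2}`. -/
def JsqrtInv (P : Params) : Matrix (Fin 3) (Fin 3) ℝ :=
  Matrix.diagonal fun i => (Real.sqrt (P.inertia i))⁻¹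

/-- A `3 + 3 + 2` block matrix. -/
def blocks (A11 A12 : Matrix (Fin 3) (Fin 3) ℂ) (A13 : Matrix (Fin 3) (Fin 2) ℂ)
    (A21 A22 : Matrix (Fin 3) (Fin 3) ℂ) (A23 : Matrix (Fin 3) (Fin 2) ℂ)
    (A31 A32 : Matrix (Fin 2) (Fin 3) ℂ) (A33 : Matrix (Fin 2) (Fin 2) ℂ) : Matrix Idx Idx ℂ :=
  Matrix.fromBlocks A11 (Matrix.fromCols A12 A13) (Matrix.fromRows A21 A31)
    (Matrix.fromBlocks A22 A23 A32 A33)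

/-- The symbol `B̂_k` of the operator `B`. -/
def symbolB (P : Params) (k : V3) : Matrix Idx Idx ℂ :=
  blocks
    (toC (-((P.mu + P.kappa / 2) * (k ⬝ᵥ k)) • projPerp k))
    ((Complex.I * (P.kappa : ℂ)) • toC (crossMat k))
    0
    ((Complex.I * (P.kappa : ℂ)) • toC (Jinv P * crossMat k * projPerp k))
    (toC (-(2 * P.kappa) • Jinv P
      - ((P.alpha + 4 * P.beta / 3) * (k ⬝ᵥ k)) • (Jinv P * projPar k)
      - ((P.beta + P.gamma) * (k ⬝ᵥ k)) • (Jinv P * projPerp k)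
      - ((1 - P.nu / P.lam) * P.rot) • R33))
    (toC (-(1 / P.lam * P.rot ^ 2) • R32))
    0
    (toC ((P.lam - P.nu) • R23))
    (toC (P.rot • R22))

/-- `T(k) = i k × / |k|`, and `T(0) = 0`. -/
def matT (k : V3) : Matrix (Fin 3) (Fin 3) ℂ :=
  (Complex.I * ((Real.sqrt (k ⬝ᵥ k) : ℝ) : ℂ)⁻¹) • toC (crossMat k)

/-- `s = -(λ - ν)^{-1/2} τ / (2κ)`. -/
def scaleS (P : Params) : ℝ := -1 / Real.sqrt (P.lam - P.nu) * P.rot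

/-- `Q_k = T(k) ⊕ J_eq^{1/2} ⊕ s R`. -/
def matQ (P : Params) (k : V3) : Matrix Idx Idx ℂ :=
  blocks (matT k) 0 0 0 (toC (Jsqrt P)) 0 0 0 (toC (scaleS P • R22))

/-- `Q̄_k = T(k) ⊕ J_eq^{-1/2} ⊕ (-s⁻¹) R`. -/
def matQbar (P : Params) (k : V3) : Matrix Idx Idx ℂ :=
  blocks (matT k) 0 0 0 (toC (JsqrtInv P)) 0 0 0 (toC (-(scaleS P)⁻¹ • R22))

/-- `M_k = Q_k B̂_k Q̄_k`. -/
def matM (P : Params) (k : V3) : Matrix Idx Idx ℂ := matQ P k * symbolB P k * matQbar P k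

/-- The real parts of all eigenvalues of all the matrices `M_k`, `k ∈ ℤ³`. -/
def growthRates (P : Params) : Set ℝ :=
  {x | ∃ (k : Fin 3 → ℤ) (w : ℂ),
    Module.End.HasEigenvalue (Matrix.toLin' (matM P (waveVec k))) w ∧ w.re = x}

end Micropolar

end

noncomputable section

namespace Micropolar

/-! The maximal rate is realised by a single real plane wave `Re (e^{wt} y e^{ik·x})`, where `y` is
an eigenvector of the symbol for an eigenvalue `w` with `Re w = η`.

Conjugation: `Q̄_k Q_k` is `T(k)² ⊕ I ⊕ I`, and `T(k)²` fixes the range of `k ×`, so `Q̄_k Q_k B̂_k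
= B̂_k`. Hence `M_k` and `B̂_k` have the same nonzero eigenvalues, and eigenvectors of `B̂_k` for
these have divergence-free velocity (`isMode_of_eigenvector`).

Positivity: at `k = 0` the horizontal parts of `ω` and `a` reduce, by circular polarization, to a
quadratic whose roots have product `-(λ-ν)d²/λ < 0` and a sum with negative real part. One root
therefore has positive real part (`exists_growing_mode`); this is where `ν < λ` causes the
instability.

Attainment: the energy identity `energy_bound` has one term of indefinite sign, the coupling of `ω`
and `a`. The angular viscosity absorbs it and gives `Re w · c|k|² ≤ d²(λ-ν)` (`IsMode.re_le`). So
only finitely many `k` carry rates above a given positive level, and the supremum is a maximum.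

Exact norms: for `k ≠ 0` the two Fourier modes `±k` are distinct and each scales by `|e^{wt}|`. For
`k = 0` they coincide, and `|Re (zc)|` scales like `|z|` only if `∑ cᵢ² = 0`;
`exists_polarized_mode` supplies an eigenvector with this property in each of `u`, `ω`, `a`. -/

/-! ## Plane waves -/

/-- The character `x ↦ e^{i k·x}`. -/
def character (k x : V3) : ℂ := Complex.exp (Complex.I * ((k ⬝ᵥ x : ℝ) : ℂ))

/-- The real plane wave `x ↦ Re (c e^{i k·x})`. -/
def wave (k : V3) (c : ℂ) (x : V3) : ℝ := (c * character k x).re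

lemma character_eq (k x : V3) :
    character k x = Complex.exp (Complex.I * (k 0 * x 0 + k 1 * x 1 + k 2 * x 2)) := by
  simp [character, dotProduct, Fin.sum_univ_three]

lemma contDiff_character (k : V3) : ContDiff ℝ ∞ (character k) := by
  have h : character k = fun x : V3 =>
      Complex.exp (Complex.I * (Complex.ofRealCLM (k 0 * x 0 + k 1 * x 1 + k 2 * x 2))) := by
    funext x; simp [character_eq]
  rw [h]; fun_prop

lemma hasLineDerivAt_wave (k : V3) (c : ℂ) (x : V3) (j : Fin 3) :
    HasLineDerivAt ℝ (wave k c) (wave k (Complex.I * k j * c) x) x (Pi.single j 1) := by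
  have h0 : HasDerivAt (fun t : ℝ => k ⬝ᵥ (x + t • (Pi.single j 1 : V3))) (k j) 0 := by
    simp only [dotProduct_add, dotProduct_smul, smul_eq_mul, dotProduct_single, mul_one]
    simpa using ((hasDerivAt_id (0 : ℝ)).mul_const (k j)).const_add (k ⬝ᵥ x)
  have h1 := ((h0.ofReal_comp.const_mul Complex.I).cexp).const_mul c
  have h2 := (Complex.reCLM.hasFDerivAt.comp_hasDerivAt (0 : ℝ) h1)
  refine HasDerivAt.congr_deriv (f := fun t : ℝ => wave k c (x + t • Pi.single j 1)) h2 ?_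
  rw [zero_smul, add_zero, Complex.reCLM_apply, wave, character]
  congr 1
  ring

lemma contDiff_wave (k : V3) (c : ℂ) : ContDiff ℝ ∞ (wave k c) :=
  Complex.reCLM.contDiff.comp (contDiff_const.mul (contDiff_character k))

lemma pderiv_wave (k : V3) (c : ℂ) (j : Fin 3) :
    pderiv j (wave k c) = wave k (Complex.I * k j * c) := by
  funext x
  have hd : DifferentiableAt ℝ (wave k c) x :=
    ((contDiff_wave k c).differentiable (by simp)).differentiableAt
  exact (hd.hasFDerivAt.hasLineDerivAt (Pi.single j 1)).unique (hasLineDerivAt_wave k c x j)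

lemma wave_add (k : V3) (c d : ℂ) (x : V3) : wave k (c + d) x = wave k c x + wave k d x := by
  simp only [wave, add_mul, Complex.add_re]

lemma wave_sub (k : V3) (c d : ℂ) (x : V3) : wave k (c - d) x = wave k c x - wave k d x := by
  simp only [wave, sub_mul, Complex.sub_re]

lemma wave_neg (k : V3) (c : ℂ) (x : V3) : wave k (-c) x = -wave k c x := by
  simp only [wave, neg_mul, Complex.neg_re]

lemma wave_real_mul (k : V3) (r : ℝ) (c : ℂ) (x : V3) :
    wave k (r * c) x = r * wave k c x := by
  simp only [wave, mul_assoc, Complex.re_ofReal_mul]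

lemma wave_zero (k : V3) (x : V3) : wave k 0 x = 0 := by simp [wave]

lemma isPeriodic_wave (k : Fin 3 → ℤ) (c : ℂ) : IsPeriodic (wave (waveVec k) c) := by
  intro x j
  have h : character (waveVec k) (x + Pi.single j (2 * Real.pi)) = character (waveVec k) x := by
    simp only [character, dotProduct_add, dotProduct_single, Complex.ofReal_add, mul_add,
      Complex.exp_add]
    rw [show Complex.I * ((waveVec k j * (2 * Real.pi) : ℝ) : ℂ)
      = (k j : ℂ) * (2 * Real.pi * Complex.I) by simp [waveVec]; ring, Complex.exp_int_mul_two_pi_mul_I,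
      mul_one]
  simp only [wave, h]

/-! ## Fourier coefficients of plane waves -/

lemma integral_exp_int (n : ℤ) :
    ∫ x in Set.Icc (0 : ℝ) (2 * Real.pi), Complex.exp (Complex.I * (n * x)) =
      if n = 0 then ((2 * Real.pi : ℝ) : ℂ) else 0 := by
  rw [integral_Icc_eq_integral_Ioc, ← intervalIntegral.integral_of_le (by positivity)]
  split_ifs with h
  · simp [h]
  · have hc : Complex.I * (n : ℂ) ≠ 0 := mul_ne_zero Complex.I_ne_zero (by exact_mod_cast h)
    have := integral_exp_mul_complex (a := 0) (b := 2 * Real.pi) hc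
    simp only [← mul_assoc]
    rw [this]
    have h1 : Complex.exp (Complex.I * n * ((2 * Real.pi : ℝ) : ℂ)) = 1 := by
      rw [← Complex.exp_int_mul_two_pi_mul_I n]; congr 1; push_cast; ring
    rw [h1]; simp

lemma integral_character (n : Fin 3 → ℤ) :
    ∫ x in Set.Icc (0 : V3) (fun _ => 2 * Real.pi), character (waveVec n) x =
      if n = 0 then (((2 * Real.pi) ^ 3 : ℝ) : ℂ) else 0 := by
  have h1 : ∀ x, character (waveVec n) x = ∏ j, Complex.exp (Complex.I * (n j * x j)) := by
    intro x
    rw [character_eq, ← Complex.exp_sum]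
    congr 1
    simp [waveVec, Fin.sum_univ_three]; ring
  simp only [h1]
  have h2 : (Set.Icc (0 : V3) (fun _ => 2 * Real.pi)) =
      Set.pi Set.univ (fun _ => Set.Icc (0 : ℝ) (2 * Real.pi)) := by
    rw [Set.pi_univ_Icc]; rfl
  rw [h2, volume_pi, Measure.restrict_pi_pi,
    integral_fintype_prod_eq_prod (𝕜 := ℂ) (fun j (t : ℝ) => Complex.exp (Complex.I * (n j * t)))]
  simp only [integral_exp_int]
  split_ifs with h
  · simp [h]
  · obtain ⟨j, hj⟩ := Function.ne_iff.mp h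
    exact Finset.prod_eq_zero (Finset.mem_univ j) (by simpa using hj)

lemma wave_eq (k : V3) (c : ℂ) (x : V3) :
    (wave k c x : ℂ) = c / 2 * character k x + star c / 2 * character (-k) x := by
  have h : character (-k) x = star (character k x) := by
    simp [character, ← Complex.exp_conj]
  rw [wave, Complex.re_eq_add_conj, h]
  simp
  ring

lemma continuous_character (k : V3) : Continuous (character k) := (contDiff_character k).continuous

/-- A real part is half a character plus half its conjugate. The two indicators are kept separate
because both are active when `k = 0`. -/
lemma fourierCoef_wave (k : Fin 3 → ℤ) (c : ℂ) (m : Fin 3 → ℤ) :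
    fourierCoef (wave (waveVec k) c) m =
      (if m = k then c / 2 else 0) + (if m = -k then star c / 2 else 0) := by
  have h1 : ∀ x, (wave (waveVec k) c x : ℂ) *
      Complex.exp (-(Complex.I * ((waveVec m ⬝ᵥ x : ℝ) : ℂ))) =
      c / 2 * character (waveVec (k - m)) x + star c / 2 * character (waveVec (-k - m)) x := by
    intro x
    rw [wave_eq, add_mul, mul_assoc, mul_assoc]
    congr 2
    all_goals
      simp only [character_eq, dotProduct, Fin.sum_univ_three, ← Complex.exp_add]
      congr 1
      simp [waveVec]
      ring
  have hint : ∀ (a : ℂ) n, IntegrableOn (fun x => a * character (waveVec n) x)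
      (Set.Icc (0 : V3) (fun _ => 2 * Real.pi)) := fun a n =>
    (continuous_const.mul (continuous_character _)).continuousOn.integrableOn_compact isCompact_Icc
  have hpi : (((2 * Real.pi) ^ 3 : ℝ) : ℂ) ≠ 0 := by
    exact_mod_cast (by positivity : (0 : ℝ) < (2 * Real.pi) ^ 3).ne'
  rw [fourierCoef]
  simp only [h1]
  rw [integral_add (hint _ _) (hint _ _), integral_const_mul, integral_const_mul,
    integral_character, integral_character]
  simp only [sub_eq_zero, eq_comm (a := m)]
  split_ifs <;> field_simp <;> simp

/-! ## Sobolev norms of polarized plane waves -/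

/-- If `∑ cᵢ² = 0`, or if `k ≠ 0`, then multiplying the polarization vector `c` by a complex
number `z` multiplies the size of each Fourier coefficient of the wave by `|z|`. -/
lemma sum_norm_sq_fourierCoef_wave {ι : Type*} [Fintype ι] (k m : Fin 3 → ℤ) (c : ι → ℂ)
    (hc : k = 0 → ∑ i, c i ^ 2 = 0) (z : ℂ) :
    ∑ i, ‖fourierCoef (fun x => wave (waveVec k) (z * c i) x) m‖ ^ 2 =
      ‖z‖ ^ 2 * ((∑ i, ‖c i‖ ^ 2) / 4 *
        ((if m = k then 1 else 0) + (if m = -k then 1 else 0))) := by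
  have h : ∀ i, fourierCoef (fun x => wave (waveVec k) (z * c i) x) m =
      (if m = k then z * c i / 2 else 0) + (if m = -k then star (z * c i) / 2 else 0) :=
    fun i => fourierCoef_wave k (z * c i) m
  simp only [h]
  by_cases h1 : m = k <;> by_cases h2 : m = -k
  -- Here `m = k = -k`, so the two contributions overlap; the resulting cross term is `Re (z² ∑ cᵢ²)
  -- / 2`, which vanishes by `hc`.
  · have hk : k = 0 := by
      funext j; have := congrFun (h1.symm.trans h2) j
      simp only [Pi.neg_apply, Pi.zero_apply] at this ⊢; omega
    have hz : (z ^ 2 * ∑ i, c i ^ 2).re = 0 := by rw [hc hk]; simp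
    rw [Finset.mul_sum, Complex.re_sum] at hz
    have key : ∀ i, ‖z * c i / 2 + star (z * c i) / 2‖ ^ 2 =
        ‖z‖ ^ 2 * (‖c i‖ ^ 2 / 2) + (z ^ 2 * c i ^ 2).re / 2 := by
      intro i
      rw [← Complex.normSq_eq_norm_sq, ← Complex.normSq_eq_norm_sq, ← Complex.normSq_eq_norm_sq]
      simp [Complex.normSq_apply, pow_two]
      ring
    simp only [if_pos h1, if_pos h2]
    rw [Finset.sum_congr rfl fun i _ => key i, Finset.sum_add_distrib, ← Finset.sum_div, hz,
      ← Finset.mul_sum, ← Finset.sum_div]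
    ring
  · simp only [if_pos h1, if_neg h2]
    simp only [add_zero, mul_one, norm_div, norm_mul, div_pow, mul_pow, ← Finset.sum_div,
      ← Finset.mul_sum]
    norm_num; ring
  · simp only [if_neg h1, if_pos h2]
    simp only [zero_add, mul_one, norm_div, norm_star, norm_mul, div_pow, mul_pow,
      ← Finset.sum_div, ← Finset.mul_sum]
    norm_num; ring
  · simp [h1, h2]

lemma sobolevTerm_wave {ι : Type*} [Fintype ι] (k m : Fin 3 → ℤ) (c : ι → ℂ)
    (hc : k = 0 → ∑ i, c i ^ 2 = 0) (z : ℂ) (r : ℝ) :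
    sobolevTerm r (fun x i => wave (waveVec k) (z * c i) x) m =
      ‖z‖ ^ 2 * sobolevTerm r (fun x i => wave (waveVec k) (c i) x) m := by
  have h1 := sum_norm_sq_fourierCoef_wave k m c hc z
  have h2 := sum_norm_sq_fourierCoef_wave k m c hc 1
  simp only [one_mul, norm_one, one_pow] at h2
  simp only [sobolevTerm]
  rw [h1, h2]; ring

lemma sobolevNorm_wave {ι : Type*} [Fintype ι] (k : Fin 3 → ℤ) (c : ι → ℂ)
    (hc : k = 0 → ∑ i, c i ^ 2 = 0) (z : ℂ) (r : ℝ) :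
    sobolevNorm r (fun x i => wave (waveVec k) (z * c i) x) =
      ‖z‖ * sobolevNorm r (fun x i => wave (waveVec k) (c i) x) := by
  simp only [sobolevNorm, sobolevTerm_wave k _ c hc z, tsum_mul_left]
  rw [Real.sqrt_mul (by positivity), Real.sqrt_sq (norm_nonneg z)]

lemma sobolevFinite_wave {ι : Type*} [Fintype ι] (k : Fin 3 → ℤ) (c : ι → ℂ) (r : ℝ) :
    SobolevFinite r (fun x i => wave (waveVec k) (c i) x) := by
  refine summable_of_ne_finset_zero (s := {k, -k}) fun m hm => ?_
  simp only [Finset.mem_insert, Finset.mem_singleton, not_or] at hm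
  have h : ∀ i, fourierCoef (fun x => wave (waveVec k) (c i) x) m = 0 := fun i =>
    (fourierCoef_wave k (c i) m).trans (by simp [hm.1, hm.2])
  simp [sobolevTerm, h]

/-- For `k = 0` a vanishing wave only says `Re c = 0`; the condition `∑ cᵢ² = 0` then removes the
imaginary part as well. -/
lemma eq_zero_of_wave_eq_zero {ι : Type*} [Fintype ι] (k : Fin 3 → ℤ) (c : ι → ℂ)
    (hc : k = 0 → ∑ i, c i ^ 2 = 0) (h : ∀ x i, wave (waveVec k) (c i) x = 0) : c = 0 := by
  have h1 := sum_norm_sq_fourierCoef_wave k k c hc 1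
  simp only [one_mul, h, fourierCoef, Complex.ofReal_zero, zero_mul, integral_zero, mul_zero,
    norm_zero, norm_one, if_true] at h1
  have h2 : ∑ i, ‖c i‖ ^ 2 = 0 := by
    have h3 : (0 : ℝ) < 1 + (if k = -k then 1 else 0) := by split_ifs <;> norm_num
    simp only [ne_eq, OfNat.ofNat_ne_zero, not_false_eq_true, zero_pow, one_pow, one_mul,
      Finset.sum_const_zero] at h1
    rcases mul_eq_zero.mp h1.symm with h4 | h4
    · linarith
    · exact absurd h4 h3.ne'
  funext i
  have := (Finset.sum_eq_zero_iff_of_nonneg (fun i _ => by positivity)).mp h2 i (Finset.mem_univ i)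
  simpa using this

/-! ## The Leray projector on plane waves -/

/-- Only the modes `±k` occur, with polarizations `c` and its conjugate. Both are orthogonal to the
real vector `k`, so the projection fixes them. -/
lemma leray_wave (k : Fin 3 → ℤ) (c : Fin 3 → ℂ) (hc : ∑ j, (waveVec k j : ℂ) * c j = 0) :
    leray (fun x i => wave (waveVec k) (c i) x) = fun x i => wave (waveVec k) (c i) x := by
  have hP : ∀ (m : V3) (b : Fin 3 → ℂ), ∑ j, (m j : ℂ) * b j = 0 → ∀ i,
      ∑ j, (projPerp m i j : ℂ) * b j = b i := by
    intro m b hb i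
    have : ∀ j, (projPerp m i j : ℂ) * b j =
        (if i = j then b j else 0) - ((m ⬝ᵥ m)⁻¹ * m i : ℝ) * (m j * b j) := by
      intro j
      simp only [projPerp, projPar, Matrix.sub_apply, Matrix.one_apply, Matrix.smul_apply,
        Matrix.vecMulVec_apply, smul_eq_mul]
      split_ifs <;> push_cast <;> ring
    simp only [this, Finset.sum_sub_distrib, ← Finset.mul_sum, hb]
    simp
  have hneg : ∑ j, (waveVec (-k) j : ℂ) * star (c j) = 0 := by
    have := congrArg star hc
    simp only [star_sum, star_mul', star_zero] at this
    rw [← neg_eq_zero, ← this, ← Finset.sum_neg_distrib]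
    exact Finset.sum_congr rfl fun j _ => by simp [waveVec]
  funext x i
  have hF : ∀ j m, fourierCoef (fun y => wave (waveVec k) (c j) y) m =
      (if m = k then c j / 2 else 0) + (if m = -k then star (c j) / 2 else 0) :=
    fun j m => fourierCoef_wave k (c j) m
  simp only [leray, hF]
  have hterm : ∀ m : Fin 3 → ℤ,
      (∑ j, (projPerp (waveVec m) i j : ℂ) *
        ((if m = k then c j / 2 else 0) + (if m = -k then star (c j) / 2 else 0))) *
        Complex.exp (Complex.I * ((waveVec m ⬝ᵥ x : ℝ) : ℂ)) =
      (if m = k then c i / 2 * character (waveVec k) x else 0) +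
        (if m = -k then star (c i) / 2 * character (waveVec (-k)) x else 0) := by
    intro m
    simp only [mul_add, Finset.sum_add_distrib, add_mul]
    congr 1
    · split_ifs with h
      · subst h
        simp only [mul_div_assoc', ← Finset.sum_div]
        rw [hP _ _ hc]; rfl
      · simp
    · split_ifs with h
      · subst h
        simp only [mul_div_assoc', ← Finset.sum_div]
        rw [hP _ _ hneg]; rfl
      · simp
  simp only [hterm]
  rw [((hasSum_ite_eq k _).add (hasSum_ite_eq (-k) _)).tsum_eq]
  have hw : waveVec (-k) = -waveVec k := by funext j; simp [waveVec]
  rw [hw, ← wave_eq, Complex.ofReal_re]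

/-! ## Algebra of the symbol -/

lemma crossMat_mul_projPerp (k : V3) : crossMat k * projPerp k = crossMat k := by
  have h : crossMat k * Matrix.vecMulVec k k = 0 := by
    ext i j
    fin_cases i <;> fin_cases j <;>
      simp [crossMat, Matrix.mul_apply, Fin.sum_univ_three, Matrix.vecMulVec_apply] <;> ring
  simp [projPerp, projPar, mul_sub, h]

lemma dotProduct_self_smul_projPar (k : V3) : (k ⬝ᵥ k) • projPar k = Matrix.vecMulVec k k := by
  by_cases h : k ⬝ᵥ k = 0
  · simp [dotProduct_self_eq_zero.mp h]
  · rw [projPar, smul_smul, mul_inv_cancel₀ h, one_smul]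

lemma crossMat_mul_self (k : V3) :
    crossMat k * crossMat k = -((k ⬝ᵥ k) • projPerp k) := by
  rw [projPerp, smul_sub, dotProduct_self_smul_projPar]
  ext i j
  fin_cases i <;> fin_cases j <;>
    simp [crossMat, Matrix.mul_apply, Fin.sum_univ_three, Matrix.vecMulVec_apply, dotProduct] <;>
    ring

lemma toC_mul {l m n : Type*} [Fintype m] (A : Matrix l m ℝ) (B : Matrix m n ℝ) :
    toC (A * B) = toC A * toC B :=
  Matrix.map_mul (f := Complex.ofRealHom)

lemma toC_smul {m n : Type*} (r : ℝ) (A : Matrix m n ℝ) : toC (r • A) = (r : ℂ) • toC A := by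
  ext i j; simp [toC]

lemma toC_neg {m n : Type*} (A : Matrix m n ℝ) : toC (-A) = -toC A := by
  ext i j; simp [toC]

lemma toC_one {n : Type*} [DecidableEq n] : toC (1 : Matrix n n ℝ) = 1 :=
  Matrix.map_one _ Complex.ofReal_zero Complex.ofReal_one

lemma crossMat_pow_three (k : V3) :
    crossMat k * (crossMat k * crossMat k) = -((k ⬝ᵥ k) • crossMat k) := by
  rw [crossMat_mul_self, mul_neg, Matrix.mul_smul, crossMat_mul_projPerp]

lemma dotProduct_self_nonneg' (k : V3) : 0 ≤ k ⬝ᵥ k := by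
  simp only [dotProduct]; exact Finset.sum_nonneg fun i _ => mul_self_nonneg _

/-- For `k ≠ 0`, `T(k)² = -(k×)²/|k|²` is the projection orthogonal to `k`, and it fixes the range
of `k ×`. For `k = 0` both sides vanish. -/
lemma matT_mul_matT_mul_crossMat (k : V3) :
    matT k * matT k * toC (crossMat k) = toC (crossMat k) := by
  by_cases h : k ⬝ᵥ k = 0
  · have h0 : crossMat k = 0 := by
      rw [dotProduct_self_eq_zero.mp h]; ext i j; fin_cases i <;> fin_cases j <;> simp [crossMat]
    simp [h0, toC]
  · have hs : ((Real.sqrt (k ⬝ᵥ k) : ℝ) : ℂ) * ((Real.sqrt (k ⬝ᵥ k) : ℝ) : ℂ) =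
        ((k ⬝ᵥ k : ℝ) : ℂ) := by
      rw [← Complex.ofReal_mul, Real.mul_self_sqrt (dotProduct_self_nonneg' k)]
    have h' : ((k ⬝ᵥ k : ℝ) : ℂ) ≠ 0 := by exact_mod_cast h
    rw [matT, Matrix.smul_mul, Matrix.mul_smul, smul_smul, Matrix.smul_mul, mul_assoc, ← toC_mul,
      ← toC_mul, mul_assoc, crossMat_pow_three, toC_neg, toC_smul, smul_neg, smul_smul, ← neg_smul]
    convert one_smul ℂ (toC (crossMat k))
    rw [← hs] at h' ⊢
    have h3 := left_ne_zero_of_mul h'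
    field_simp
    simp

/-- With the factor `k ×` on the left, this block too is fixed by `T(k)²`. -/
lemma projPerp_symbol (P : Params) (k : V3) :
    toC (-((P.mu + P.kappa / 2) * (k ⬝ᵥ k)) • projPerp k) =
      toC (crossMat k) * (((P.mu + P.kappa / 2 : ℝ) : ℂ) • toC (crossMat k)) := by
  rw [Matrix.mul_smul, ← toC_mul, crossMat_mul_self, ← toC_smul, smul_neg, smul_smul, neg_smul]

lemma scaleS_ne_zero (P : Params) (hk : 0 < P.kappa) (ht : 0 < P.tau) (hl : P.nu < P.lam) :
    scaleS P ≠ 0 := by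
  have h1 : 0 < P.rot := div_pos ht (by positivity)
  have h2 : 0 < Real.sqrt (P.lam - P.nu) := Real.sqrt_pos.mpr (by linarith)
  simp only [scaleS]
  exact mul_ne_zero (div_ne_zero (by norm_num) h2.ne') h1.ne'

lemma blocks_mul_blocks (A B : Matrix (Fin 3) (Fin 3) ℂ) (C D : Matrix (Fin 3) (Fin 3) ℂ)
    (E F : Matrix (Fin 2) (Fin 2) ℂ) :
    blocks A 0 0 0 C 0 0 0 E * blocks B 0 0 0 D 0 0 0 F =
      blocks (A * B) 0 0 0 (C * D) 0 0 0 (E * F) := by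
  ext i j
  rcases i with i | i | i <;> rcases j with j | j | j <;>
    simp [blocks, Matrix.mul_apply, Fintype.sum_sum_type]

lemma blocks_diag_mul (A C : Matrix (Fin 3) (Fin 3) ℂ) (E : Matrix (Fin 2) (Fin 2) ℂ)
    (A11 A12 : Matrix (Fin 3) (Fin 3) ℂ) (A13 : Matrix (Fin 3) (Fin 2) ℂ)
    (A21 A22 : Matrix (Fin 3) (Fin 3) ℂ) (A23 : Matrix (Fin 3) (Fin 2) ℂ)
    (A31 A32 : Matrix (Fin 2) (Fin 3) ℂ) (A33 : Matrix (Fin 2) (Fin 2) ℂ) :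
    blocks A 0 0 0 C 0 0 0 E * blocks A11 A12 A13 A21 A22 A23 A31 A32 A33 =
      blocks (A * A11) (A * A12) (A * A13) (C * A21) (C * A22) (C * A23)
        (E * A31) (E * A32) (E * A33) := by
  ext i j
  rcases i with i | i | i <;> rcases j with j | j | j <;>
    simp [blocks, Matrix.mul_apply, Fintype.sum_sum_type]

lemma inertia_pos (P : Params) (hn : 0 < P.nu) (hl : P.nu < P.lam) (i : Fin 3) :
    0 < P.inertia i := by
  fin_cases i <;> simp [Params.inertia] <;> linarith

lemma matQbar_mul_matQ (P : Params) (k : V3) (hk : 0 < P.kappa) (ht : 0 < P.tau) (hn : 0 < P.nu)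
    (hl : P.nu < P.lam) :
    matQbar P k * matQ P k = blocks (matT k * matT k) 0 0 0 1 0 0 0 1 := by
  rw [matQbar, matQ, blocks_mul_blocks]
  congr 1
  · rw [← toC_mul, JsqrtInv, Jsqrt, Matrix.diagonal_mul_diagonal, ← toC_one, ← Matrix.diagonal_one]
    congr 2
    funext i
    exact inv_mul_cancel₀ (Real.sqrt_pos.mpr (inertia_pos P hn hl i)).ne'
  · rw [← toC_mul, ← toC_one]
    congr 1
    have hs := scaleS_ne_zero P hk ht hl
    ext i j
    fin_cases i <;> fin_cases j <;> simp [R22, Matrix.mul_apply, hs]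

lemma matQbar_mul_matQ_mul_symbolB (P : Params) (k : V3) (hk : 0 < P.kappa) (ht : 0 < P.tau)
    (hn : 0 < P.nu) (hl : P.nu < P.lam) :
    matQbar P k * matQ P k * symbolB P k = symbolB P k := by
  rw [matQbar_mul_matQ P k hk ht hn hl, symbolB, blocks_diag_mul]
  simp only [Matrix.one_mul, Matrix.mul_zero, projPerp_symbol, Matrix.mul_smul, ← mul_assoc,
    matT_mul_matT_mul_crossMat]

/-- The matrices `Q B Q̄` and `Q̄ Q B = B` share their nonzero eigenvalues: `Q̄` carries
eigenvectors of the first to the second, and does not kill them because `w ≠ 0`. -/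
lemma exists_eigenvector_symbolB (P : Params) (k : V3) (hk : 0 < P.kappa) (ht : 0 < P.tau)
    (hn : 0 < P.nu) (hl : P.nu < P.lam) (w : ℂ) (hw : w ≠ 0)
    (h : Module.End.HasEigenvalue (Matrix.toLin' (matM P k)) w) :
    ∃ y : Idx → ℂ, y ≠ 0 ∧ symbolB P k *ᵥ y = w • y := by
  obtain ⟨v, hv⟩ := h.exists_hasEigenvector
  have h1 : matM P k *ᵥ v = w • v := by simpa using hv.apply_eq_smul
  have h2 : matQ P k *ᵥ (symbolB P k *ᵥ (matQbar P k *ᵥ v)) = w • v := by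
    rw [← h1, matM, Matrix.mulVec_mulVec, Matrix.mulVec_mulVec, mul_assoc]
  refine ⟨matQbar P k *ᵥ v, fun h0 => ?_, ?_⟩
  · rw [h0, Matrix.mulVec_zero, Matrix.mulVec_zero] at h2
    exact (smul_ne_zero hw hv.2) h2.symm
  · have h3 := congrArg (fun z => matQbar P k *ᵥ z) h2
    simp only [Matrix.mulVec_mulVec, Matrix.mulVec_smul] at h3
    rw [← h3, ← mul_assoc, ← mul_assoc, matQbar_mul_matQ_mul_symbolB P k hk ht hn hl,
      Matrix.mulVec_mulVec]

lemma hasEigenvalue_matM (P : Params) (k : V3) (hk : 0 < P.kappa) (ht : 0 < P.tau)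
    (hn : 0 < P.nu) (hl : P.nu < P.lam) (w : ℂ) (hw : w ≠ 0) (y : Idx → ℂ) (hy : y ≠ 0)
    (h : symbolB P k *ᵥ y = w • y) :
    Module.End.HasEigenvalue (Matrix.toLin' (matM P k)) w := by
  have h1 : matQbar P k *ᵥ (matQ P k *ᵥ (w • y)) = w • y := by
    rw [← h, Matrix.mulVec_mulVec, Matrix.mulVec_mulVec, matQbar_mul_matQ_mul_symbolB P k hk ht hn hl]
  have h2 : matQbar P k *ᵥ (matQ P k *ᵥ y) = y := by
    rw [Matrix.mulVec_smul, Matrix.mulVec_smul] at h1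
    exact smul_right_injective _ hw h1
  refine Module.End.hasEigenvalue_of_hasEigenvector (x := matQ P k *ᵥ y)
    (Module.End.hasEigenvector_iff.mpr ⟨Module.End.mem_eigenspace_iff.mpr ?_, fun h0 => hy ?_⟩)
  · rw [Matrix.toLin'_apply, matM, ← Matrix.mulVec_mulVec, ← Matrix.mulVec_mulVec, h2, h,
      Matrix.mulVec_smul]
  · rw [← h2, h0, Matrix.mulVec_zero]

/-! ## Modes -/

/-- The eigenvalue equations, at wavenumber `k` and for the eigenvalue `w`, of the linearized
operator restricted to divergence-free velocities, in components. -/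
structure IsMode (P : Params) (k : V3) (w : ℂ) (y : Idx → ℂ) : Prop where
  div_free : k 0 * y (.inl 0) + k 1 * y (.inl 1) + k 2 * y (.inl 2) = 0
  u0 : w * y (.inl 0) = -(P.mu + P.kappa / 2) * (k ⬝ᵥ k : ℝ) * y (.inl 0) +
    Complex.I * P.kappa * (k 1 * y (.inr (.inl 2)) - k 2 * y (.inr (.inl 1)))
  u1 : w * y (.inl 1) = -(P.mu + P.kappa / 2) * (k ⬝ᵥ k : ℝ) * y (.inl 1) +
    Complex.I * P.kappa * (k 2 * y (.inr (.inl 0)) - k 0 * y (.inr (.inl 2)))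
  u2 : w * y (.inl 2) = -(P.mu + P.kappa / 2) * (k ⬝ᵥ k : ℝ) * y (.inl 2) +
    Complex.I * P.kappa * (k 0 * y (.inr (.inl 1)) - k 1 * y (.inr (.inl 0)))
  w0 : P.lam * (w * y (.inr (.inl 0))) =
    Complex.I * P.kappa * (k 1 * y (.inl 2) - k 2 * y (.inl 1))
    - 2 * P.kappa * y (.inr (.inl 0))
    - (P.alpha + P.beta / 3 - P.gamma) * k 0 * (k 0 * y (.inr (.inl 0)) +
      k 1 * y (.inr (.inl 1)) + k 2 * y (.inr (.inl 2)))
    - (P.beta + P.gamma) * (k ⬝ᵥ k : ℝ) * y (.inr (.inl 0))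
    + (P.lam - P.nu) * P.rot * y (.inr (.inl 1)) + P.rot ^ 2 * y (.inr (.inr 1))
  w1 : P.lam * (w * y (.inr (.inl 1))) =
    Complex.I * P.kappa * (k 2 * y (.inl 0) - k 0 * y (.inl 2))
    - 2 * P.kappa * y (.inr (.inl 1))
    - (P.alpha + P.beta / 3 - P.gamma) * k 1 * (k 0 * y (.inr (.inl 0)) +
      k 1 * y (.inr (.inl 1)) + k 2 * y (.inr (.inl 2)))
    - (P.beta + P.gamma) * (k ⬝ᵥ k : ℝ) * y (.inr (.inl 1))
    - (P.lam - P.nu) * P.rot * y (.inr (.inl 0)) - P.rot ^ 2 * y (.inr (.inr 0))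
  w2 : P.nu * (w * y (.inr (.inl 2))) =
    Complex.I * P.kappa * (k 0 * y (.inl 1) - k 1 * y (.inl 0))
    - 2 * P.kappa * y (.inr (.inl 2))
    - (P.alpha + P.beta / 3 - P.gamma) * k 2 * (k 0 * y (.inr (.inl 0)) +
      k 1 * y (.inr (.inl 1)) + k 2 * y (.inr (.inl 2)))
    - (P.beta + P.gamma) * (k ⬝ᵥ k : ℝ) * y (.inr (.inl 2))
  a0 : w * y (.inr (.inr 0)) =
    -((P.lam - P.nu) * y (.inr (.inl 1)) + P.rot * y (.inr (.inr 1)))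
  a1 : w * y (.inr (.inr 1)) =
    (P.lam - P.nu) * y (.inr (.inl 0)) + P.rot * y (.inr (.inr 0))

/-- The symbol without the inverse of `|k|²`. -/
lemma symbolB_eq (P : Params) (k : V3) : symbolB P k =
  blocks
    (toC (-(P.mu + P.kappa / 2) • ((k ⬝ᵥ k) • 1 - Matrix.vecMulVec k k)))
    ((Complex.I * (P.kappa : ℂ)) • toC (crossMat k))
    0
    ((Complex.I * (P.kappa : ℂ)) • toC (Jinv P * crossMat k))
    (toC (Jinv P * (-(2 * P.kappa) • 1
      - (P.alpha + P.beta / 3 - P.gamma) • Matrix.vecMulVec k k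
      - ((P.beta + P.gamma) * (k ⬝ᵥ k)) • 1)
      - ((1 - P.nu / P.lam) * P.rot) • R33))
    (toC (-(1 / P.lam * P.rot ^ 2) • R32))
    0
    (toC ((P.lam - P.nu) • R23))
    (toC (P.rot • R22)) := by
  have h1 : (k ⬝ᵥ k) • projPerp k = (k ⬝ᵥ k) • 1 - Matrix.vecMulVec k k := by
    rw [projPerp, smul_sub, dotProduct_self_smul_projPar]
  rw [symbolB]
  congr 1
  · rw [← neg_mul, mul_smul, h1]
  · rw [mul_assoc, crossMat_mul_projPerp]
  · congr 2
    -- The coefficient of `k ⊗ k` becomes `(α + 4β/3) - (β + γ) = α + β/3 - γ`.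
    simp only [mul_smul, ← Matrix.mul_smul, h1, dotProduct_self_smul_projPar]
    simp only [Matrix.mul_sub, Matrix.mul_smul, Matrix.mul_one]
    module

lemma sum_eq_zero_of_eigenvector (P : Params) (k : V3) (w : ℂ) (hw : w ≠ 0) (y : Idx → ℂ)
    (h : symbolB P k *ᵥ y = w • y) :
    (k 0 * y (.inl 0) + k 1 * y (.inl 1) + k 2 * y (.inl 2) : ℂ) = 0 := by
  rw [symbolB_eq] at h
  have e := fun i => congrFun h (.inl i)
  have e0 := e 0
  have e1 := e 1
  have e2 := e 2
  simp [blocks, toC, Matrix.mulVec, dotProduct, Fintype.sum_sum_type, Fin.sum_univ_three,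
    Matrix.vecMulVec_apply, crossMat, Matrix.one_apply] at e0 e1 e2
  -- The velocity rows map into the complement of `k`, so pairing them with `k` leaves `w (k·u) =
  -- 0`.
  refine (mul_eq_zero.mp ?_).resolve_left hw
  linear_combination -(k 0 : ℂ) * e0 - k 1 * e1 - k 2 * e2

lemma isMode_of_eigenvector (P : Params) (k : V3) (hn : 0 < P.nu)
    (hl : P.nu < P.lam) (w : ℂ) (hw : w ≠ 0) (y : Idx → ℂ)
    (h : symbolB P k *ᵥ y = w • y) : IsMode P k w y := by
  have hd := sum_eq_zero_of_eigenvector P k w hw y h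
  rw [symbolB_eq] at h
  have hlam : (P.lam : ℂ) ≠ 0 := by exact_mod_cast (hn.trans hl).ne'
  have hnu : (P.nu : ℂ) ≠ 0 := by exact_mod_cast hn.ne'
  have e0 := congrFun h (.inl 0)
  have e1 := congrFun h (.inl 1)
  have e2 := congrFun h (.inl 2)
  have e3 := congrFun h (.inr (.inl 0))
  have e4 := congrFun h (.inr (.inl 1))
  have e5 := congrFun h (.inr (.inl 2))
  have e6 := congrFun h (.inr (.inr 0))
  have e7 := congrFun h (.inr (.inr 1))
  simp [blocks, toC, Matrix.mulVec, dotProduct, Fintype.sum_sum_type, Fin.sum_univ_three,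
    Matrix.vecMulVec_apply, crossMat, Matrix.one_apply, R22, R23, R32, R33, Jinv, Matrix.diagonal_mul,
    Params.inertia]
    at e0 e1 e2 e3 e4 e5 e6 e7
  constructor
  · exact hd
  · simp [dotProduct, Fin.sum_univ_three]
    linear_combination -e0 + (P.mu + P.kappa / 2) * k 0 * hd
  · simp [dotProduct, Fin.sum_univ_three]
    linear_combination -e1 + (P.mu + P.kappa / 2) * k 1 * hd
  · simp [dotProduct, Fin.sum_univ_three]
    linear_combination -e2 + (P.mu + P.kappa / 2) * k 2 * hd
  · simp [dotProduct, Fin.sum_univ_three]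
    rw [← e3]; field_simp; ring
  · simp [dotProduct, Fin.sum_univ_three]
    rw [← e4]; field_simp; ring
  · simp [dotProduct, Fin.sum_univ_three]
    rw [← e5]; field_simp; ring
  · linear_combination -e6
  · linear_combination -e7

/-! ## Decay of the growth rate for large wavenumbers -/

/-- This is the real part of the equations paired with the conjugate of the mode, primes denoting
imaginary parts. The weight `g' = d²/(λ-ν) = s²` on `a` makes the two couplings of `ω` and `a`
equal, whence the factor `2d²`. Since `|k×u|² = |k|²|u|²` for `k·u = 0`, the remaining `κ` terms
complete to squares. -/
lemma energy_bound {m κ p q l n d g g' K k0 k1 k2 wr wi : ℝ}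
    {u0 u0' u1 u1' u2 u2' w0 w0' w1 w1' w2 w2' a0 a0' a1 a1' : ℝ}
    (hK : K = k0 * k0 + k1 * k1 + k2 * k2)
    (hg : g = (l - n) * d) (hg' : g' * (l - n) = d ^ 2)
    (hd : k0 * u0 + k1 * u1 + k2 * u2 = 0) (hd' : k0 * u0' + k1 * u1' + k2 * u2' = 0)
    (e0 : wr * u0 - wi * u0' = -(m + κ / 2) * K * u0 - κ * (k1 * w2' - k2 * w1'))
    (e0' : wr * u0' + wi * u0 = -(m + κ / 2) * K * u0' + κ * (k1 * w2 - k2 * w1))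
    (e1 : wr * u1 - wi * u1' = -(m + κ / 2) * K * u1 - κ * (k2 * w0' - k0 * w2'))
    (e1' : wr * u1' + wi * u1 = -(m + κ / 2) * K * u1' + κ * (k2 * w0 - k0 * w2))
    (e2 : wr * u2 - wi * u2' = -(m + κ / 2) * K * u2 - κ * (k0 * w1' - k1 * w0'))
    (e2' : wr * u2' + wi * u2 = -(m + κ / 2) * K * u2' + κ * (k0 * w1 - k1 * w0))
    (f0 : l * (wr * w0 - wi * w0') = -κ * (k1 * u2' - k2 * u1') - 2 * κ * w0
      - p * k0 * (k0 * w0 + k1 * w1 + k2 * w2) - q * K * w0 + g * w1 + d ^ 2 * a1)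
    (f0' : l * (wr * w0' + wi * w0) = κ * (k1 * u2 - k2 * u1) - 2 * κ * w0'
      - p * k0 * (k0 * w0' + k1 * w1' + k2 * w2') - q * K * w0' + g * w1' + d ^ 2 * a1')
    (f1 : l * (wr * w1 - wi * w1') = -κ * (k2 * u0' - k0 * u2') - 2 * κ * w1
      - p * k1 * (k0 * w0 + k1 * w1 + k2 * w2) - q * K * w1 - g * w0 - d ^ 2 * a0)
    (f1' : l * (wr * w1' + wi * w1) = κ * (k2 * u0 - k0 * u2) - 2 * κ * w1'
      - p * k1 * (k0 * w0' + k1 * w1' + k2 * w2') - q * K * w1' - g * w0' - d ^ 2 * a0')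
    (f2 : n * (wr * w2 - wi * w2') = -κ * (k0 * u1' - k1 * u0') - 2 * κ * w2
      - p * k2 * (k0 * w0 + k1 * w1 + k2 * w2) - q * K * w2)
    (f2' : n * (wr * w2' + wi * w2) = κ * (k0 * u1 - k1 * u0) - 2 * κ * w2'
      - p * k2 * (k0 * w0' + k1 * w1' + k2 * w2') - q * K * w2')
    (b0 : wr * a0 - wi * a0' = -((l - n) * w1 + d * a1))
    (b0' : wr * a0' + wi * a0 = -((l - n) * w1' + d * a1'))
    (b1 : wr * a1 - wi * a1' = (l - n) * w0 + d * a0)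
    (b1' : wr * a1' + wi * a1 = (l - n) * w0' + d * a0') :
    wr * (u0 ^ 2 + u0' ^ 2 + u1 ^ 2 + u1' ^ 2 + u2 ^ 2 + u2' ^ 2
      + l * (w0 ^ 2 + w0' ^ 2 + w1 ^ 2 + w1' ^ 2) + n * (w2 ^ 2 + w2' ^ 2)
      + g' * (a0 ^ 2 + a0' ^ 2 + a1 ^ 2 + a1' ^ 2)) =
    -m * K * (u0 ^ 2 + u0' ^ 2 + u1 ^ 2 + u1' ^ 2 + u2 ^ 2 + u2' ^ 2)
    - κ / 2 * ((k1 * u2' - k2 * u1' + 2 * w0) ^ 2 + (k1 * u2 - k2 * u1 - 2 * w0') ^ 2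
      + (k2 * u0' - k0 * u2' + 2 * w1) ^ 2 + (k2 * u0 - k0 * u2 - 2 * w1') ^ 2
      + (k0 * u1' - k1 * u0' + 2 * w2) ^ 2 + (k0 * u1 - k1 * u0 - 2 * w2') ^ 2)
    - p * ((k0 * w0 + k1 * w1 + k2 * w2) ^ 2 + (k0 * w0' + k1 * w1' + k2 * w2') ^ 2)
    - q * K * (w0 ^ 2 + w0' ^ 2 + w1 ^ 2 + w1' ^ 2 + w2 ^ 2 + w2' ^ 2)
    + 2 * d ^ 2 * (w0 * a1 + w0' * a1' - w1 * a0 - w1' * a0') := by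
  subst hK hg
  linear_combination u0 * e0 + u0' * e0' + u1 * e1 + u1' * e1' + u2 * e2 + u2' * e2'
    + w0 * f0 + w0' * f0' + w1 * f1 + w1' * f1' + w2 * f2 + w2' * f2'
    + g' * (a0 * b0 + a0' * b0' + a1 * b1 + a1' * b1')
    + (w0 * a1 + w0' * a1' - w1 * a0 - w1' * a0') * hg'
    - κ / 2 * (k0 * u0 + k1 * u1 + k2 * u2) * hd - κ / 2 * (k0 * u0' + k1 * u1' + k2 * u2') * hd'

/-- Coercivity of `(p + q) |k·ω|² + q |k×ω|²`. -/
lemma coercive {p q c K k0 k1 k2 w0 w1 w2 : ℝ} (hK : K = k0 * k0 + k1 * k1 + k2 * k2)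
    (h1 : c ≤ p + q) (h2 : c ≤ q) :
    c * K * (w0 ^ 2 + w1 ^ 2 + w2 ^ 2) ≤
      p * (k0 * w0 + k1 * w1 + k2 * w2) ^ 2 + q * K * (w0 ^ 2 + w1 ^ 2 + w2 ^ 2) := by
  have h3 : 0 ≤ (p + q - c) * (k0 * w0 + k1 * w1 + k2 * w2) ^ 2 :=
    mul_nonneg (by linarith) (sq_nonneg _)
  have h4 : 0 ≤ (q - c) * ((k0 * w1 - k1 * w0) ^ 2 + (k1 * w2 - k2 * w1) ^ 2 +
    (k2 * w0 - k0 * w2) ^ 2) := mul_nonneg (by linarith) (by positivity)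
  subst hK
  -- By Lagrange's identity `|k|²|ω|² = (k·ω)² + |k×ω|²`, the difference of the two sides is the sum
  -- of `h3` and `h4`.
  nlinarith [h3, h4]

lemma cross_term_bound {D c w a : ℝ} (hc : 0 < c) : 2 * D * (w * a) ≤ c * w ^ 2 + D ^ 2 / c * a ^ 2 := by
  have h : 0 ≤ (c * w - D * a) ^ 2 / c := by positivity
  have h2 : (c * w - D * a) ^ 2 / c = c * w ^ 2 + D ^ 2 / c * a ^ 2 - 2 * D * (w * a) := by
    field_simp; ring
  linarith

/-- Young's inequality with weight `c|k|²` bounds the coupling by the angular dissipation plus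
`d⁴/(c|k|²) |a|²`. If the claim failed, the term `Re w · d²/(λ-ν) · |a|²` would dominate this
remainder and force `y = 0`. -/
lemma IsMode.re_le {P : Params} {k : V3} {w : ℂ} {y : Idx → ℂ} (hy : IsMode P k w y)
    (hy0 : y ≠ 0) (hmu : 0 < P.mu) (hkappa : 0 < P.kappa)
    (halpha : 0 < P.alpha + 4 * P.beta / 3) (hgamma : 0 < P.beta + P.gamma)
    (hrot : 0 < P.rot) (hnu : 0 < P.nu) (hl : P.nu < P.lam) (hw : 0 < w.re) :
    w.re * (min (P.alpha + 4 * P.beta / 3) (P.beta + P.gamma) * (k ⬝ᵥ k)) ≤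
      P.rot ^ 2 * (P.lam - P.nu) := by
  set c := min (P.alpha + 4 * P.beta / 3) (P.beta + P.gamma) with hc
  have hc0 : 0 < c := lt_min halpha hgamma
  have hln : 0 < P.lam - P.nu := sub_pos.mpr hl
  rcases (dotProduct_self_nonneg' k).eq_or_lt with hK0 | hK0
  · rw [← hK0]; simp only [mul_zero]; positivity
  have hK : k ⬝ᵥ k = k 0 * k 0 + k 1 * k 1 + k 2 * k 2 := by
    simp [dotProduct, Fin.sum_univ_three]
  obtain ⟨hd, e0, e1, e2, f0, f1, f2, b0, b1⟩ := hy
  simp only [Complex.ext_iff] at hd e0 e1 e2 f0 f1 f2 b0 b1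
  simp at hd e0 e1 e2 f0 f1 f2 b0 b1
  set K := k ⬝ᵥ k
  have hpow : ((P.rot : ℂ) ^ 2).re = P.rot ^ 2 ∧ ((P.rot : ℂ) ^ 2).im = 0 := by
    rw [← Complex.ofReal_pow]; exact ⟨Complex.ofReal_re _, Complex.ofReal_im _⟩
  rw [hpow.1, hpow.2] at f0 f1
  have E := energy_bound (m := P.mu) (κ := P.kappa) (p := P.alpha + P.beta / 3 - P.gamma)
    (q := P.beta + P.gamma) (l := P.lam) (n := P.nu) (d := P.rot) (g := (P.lam - P.nu) * P.rot)
    (g' := P.rot ^ 2 / (P.lam - P.nu)) (wr := w.re) (wi := w.im) hK rfl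
    (by field_simp) hd.1 hd.2
    (e0.1.trans (by ring)) (e0.2.trans (by ring)) (e1.1.trans (by ring)) (e1.2.trans (by ring))
    (e2.1.trans (by ring)) (e2.2.trans (by ring)) (f0.1.trans (by ring)) (f0.2.trans (by ring))
    (f1.1.trans (by ring)) (f1.2.trans (by ring)) (f2.1.trans (by ring)) (f2.2.trans (by ring))
    (b0.1.trans (by ring)) (b0.2.trans (by ring)) (b1.1.trans (by ring)) (b1.2.trans (by ring))
  have hcK : 0 < c * K := mul_pos hc0 hK0
  have c1 := coercive (w0 := (y (.inr (.inl 0))).re) (w1 := (y (.inr (.inl 1))).re)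
    (w2 := (y (.inr (.inl 2))).re) (p := P.alpha + P.beta / 3 - P.gamma) hK
    (by linarith [min_le_left (P.alpha + 4 * P.beta / 3) (P.beta + P.gamma)])
    (min_le_right (P.alpha + 4 * P.beta / 3) (P.beta + P.gamma))
  have c2 := coercive (w0 := (y (.inr (.inl 0))).im) (w1 := (y (.inr (.inl 1))).im)
    (w2 := (y (.inr (.inl 2))).im) (p := P.alpha + P.beta / 3 - P.gamma) hK
    (by linarith [min_le_left (P.alpha + 4 * P.beta / 3) (P.beta + P.gamma)])
    (min_le_right (P.alpha + 4 * P.beta / 3) (P.beta + P.gamma))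
  rw [← hc] at c1 c2
  have d1 := cross_term_bound (D := P.rot ^ 2) (w := (y (.inr (.inl 0))).re)
    (a := (y (.inr (.inr 1))).re) hcK
  have d2 := cross_term_bound (D := P.rot ^ 2) (w := (y (.inr (.inl 0))).im)
    (a := (y (.inr (.inr 1))).im) hcK
  have d3 := cross_term_bound (D := P.rot ^ 2) (w := (y (.inr (.inl 1))).re)
    (a := -(y (.inr (.inr 0))).re) hcK
  have d4 := cross_term_bound (D := P.rot ^ 2) (w := (y (.inr (.inl 1))).im)
    (a := -(y (.inr (.inr 0))).im) hcK
  by_contra hcon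
  rw [not_le] at hcon
  refine hy0 ?_
  have hlam : 0 < P.lam := hnu.trans hl
  have hgap : 0 < w.re * (P.rot ^ 2 / (P.lam - P.nu)) - (P.rot ^ 2) ^ 2 / (c * K) := by
    rw [sub_pos, div_lt_iff₀ hcK]
    calc (P.rot ^ 2) ^ 2 = P.rot ^ 2 / (P.lam - P.nu) * (P.rot ^ 2 * (P.lam - P.nu)) := by
          field_simp
      _ < P.rot ^ 2 / (P.lam - P.nu) * (w.re * (c * K)) := by gcongr
      _ = _ := by ring
  set G := w.re * (P.rot ^ 2 / (P.lam - P.nu)) - (P.rot ^ 2) ^ 2 / (c * K) with hG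
  have hN : ∀ i, Complex.normSq (y i) = (y i).re ^ 2 + (y i).im ^ 2 := fun i => by
    rw [Complex.normSq_apply]; ring
  have hN0 : ∀ i, 0 ≤ Complex.normSq (y i) := fun i => Complex.normSq_nonneg _
  have hmK : 0 ≤ P.mu * K * ((y (.inl 0)).re ^ 2 + (y (.inl 0)).im ^ 2 + (y (.inl 1)).re ^ 2
      + (y (.inl 1)).im ^ 2 + (y (.inl 2)).re ^ 2 + (y (.inl 2)).im ^ 2) := by positivity
  have hsq : 0 ≤ P.kappa / 2 * (
      (k 1 * (y (.inl 2)).im - k 2 * (y (.inl 1)).im + 2 * (y (.inr (.inl 0))).re) ^ 2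
      + (k 1 * (y (.inl 2)).re - k 2 * (y (.inl 1)).re - 2 * (y (.inr (.inl 0))).im) ^ 2
      + (k 2 * (y (.inl 0)).im - k 0 * (y (.inl 2)).im + 2 * (y (.inr (.inl 1))).re) ^ 2
      + (k 2 * (y (.inl 0)).re - k 0 * (y (.inl 2)).re - 2 * (y (.inr (.inl 1))).im) ^ 2
      + (k 0 * (y (.inl 1)).im - k 1 * (y (.inl 0)).im + 2 * (y (.inr (.inl 2))).re) ^ 2
      + (k 0 * (y (.inl 1)).re - k 1 * (y (.inl 0)).re - 2 * (y (.inr (.inl 2))).im) ^ 2) := by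
    positivity
  have hz2 : 0 ≤ c * K * ((y (.inr (.inl 2))).re ^ 2 + (y (.inr (.inl 2))).im ^ 2) := by
    positivity
  have total : w.re * (Complex.normSq (y (.inl 0)) + Complex.normSq (y (.inl 1)) +
      Complex.normSq (y (.inl 2))) + w.re * P.lam * (Complex.normSq (y (.inr (.inl 0))) +
      Complex.normSq (y (.inr (.inl 1)))) + w.re * P.nu * Complex.normSq (y (.inr (.inl 2))) +
      G * (Complex.normSq (y (.inr (.inr 0))) + Complex.normSq (y (.inr (.inr 1)))) ≤ 0 := by
    simp only [hN, hG]
    linear_combination E + c1 + c2 + d1 + d2 + d3 + d4 + hmK + hsq + hz2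
  have hwl : 0 < w.re * P.lam := mul_pos hw hlam
  have hwn : 0 < w.re * P.nu := mul_pos hw hnu
  have t := fun i => mul_nonneg hw.le (hN0 i)
  have tl := fun i => mul_nonneg hwl.le (hN0 i)
  have tn := fun i => mul_nonneg hwn.le (hN0 i)
  have tG := fun i => mul_nonneg hgap.le (hN0 i)
  have fin : ∀ (r : ℝ) i, 0 < r → r * Complex.normSq (y i) ≤ 0 → y i = 0 := fun r i hr h =>
    Complex.normSq_eq_zero.mp (le_antisymm (nonpos_of_mul_nonpos_right h hr) (hN0 i))
  have t0 := t (.inl 0)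
  have t1 := t (.inl 1)
  have t2 := t (.inl 2)
  have t3 := tl (.inr (.inl 0))
  have t4 := tl (.inr (.inl 1))
  have t5 := tn (.inr (.inl 2))
  have t6 := tG (.inr (.inr 0))
  have t7 := tG (.inr (.inr 1))
  funext i
  rcases i with i | i | i <;> fin_cases i
  · exact fin _ _ hw (by dsimp; linarith only [total, t0, t1, t2, t3, t4, t5, t6, t7])
  · exact fin _ _ hw (by dsimp; linarith only [total, t0, t1, t2, t3, t4, t5, t6, t7])
  · exact fin _ _ hw (by dsimp; linarith only [total, t0, t1, t2, t3, t4, t5, t6, t7])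
  · exact fin _ _ hwl (by dsimp; linarith only [total, t0, t1, t2, t3, t4, t5, t6, t7])
  · exact fin _ _ hwl (by dsimp; linarith only [total, t0, t1, t2, t3, t4, t5, t6, t7])
  · exact fin _ _ hwn (by dsimp; linarith only [total, t0, t1, t2, t3, t4, t5, t6, t7])
  · exact fin _ _ hgap (by dsimp; linarith only [total, t0, t1, t2, t3, t4, t5, t6, t7])
  · exact fin _ _ hgap (by dsimp; linarith only [total, t0, t1, t2, t3, t4, t5, t6, t7])

lemma IsMode.symbolB_mulVec {P : Params} {k : V3} {w : ℂ} {y : Idx → ℂ} (hy : IsMode P k w y)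
    (hn : 0 < P.nu) (hl : P.nu < P.lam) : symbolB P k *ᵥ y = w • y := by
  have hlam : (P.lam : ℂ) ≠ 0 := by exact_mod_cast (hn.trans hl).ne'
  have hnu : (P.nu : ℂ) ≠ 0 := by exact_mod_cast hn.ne'
  obtain ⟨hd, e0, e1, e2, f0, f1, f2, b0, b1⟩ := hy
  simp [dotProduct, Fin.sum_univ_three] at e0 e1 e2 f0 f1 f2 b0 b1
  rw [symbolB_eq]
  funext i
  rcases i with i | i | i <;> fin_cases i <;>
  simp [blocks, toC, Matrix.mulVec, dotProduct, Fintype.sum_sum_type, Fin.sum_univ_three,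
    Matrix.vecMulVec_apply, crossMat, Matrix.one_apply, R22, R23, R32, R33, Jinv,
    Matrix.diagonal_mul, Params.inertia]
  · linear_combination -e0 + (P.mu + P.kappa / 2) * k 0 * hd
  · linear_combination -e1 + (P.mu + P.kappa / 2) * k 1 * hd
  · linear_combination -e2 + (P.mu + P.kappa / 2) * k 2 * hd
  · rw [← mul_right_inj' hlam, f0]; field_simp; ring
  · rw [← mul_right_inj' hlam, f1]; field_simp; ring
  · rw [← mul_right_inj' hnu, f2]; field_simp; ring
  · linear_combination -b0
  · linear_combination -b1

/-- With `z = e^{wt}` this makes the time-evolved amplitude a mode at every instant. -/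
lemma IsMode.smul {P : Params} {k : V3} {w : ℂ} {y : Idx → ℂ} (hy : IsMode P k w y) (z : ℂ) :
    IsMode P k w (fun i => z * y i) := by
  obtain ⟨hd, e0, e1, e2, f0, f1, f2, b0, b1⟩ := hy
  exact ⟨by linear_combination z * hd, by linear_combination z * e0, by linear_combination z * e1,
    by linear_combination z * e2, by linear_combination z * f0, by linear_combination z * f1,
    by linear_combination z * f2, by linear_combination z * b0, by linear_combination z * b1⟩

/-! ## Spatially homogeneous modes -/

/-- A spatially homogeneous circularly polarized state, for `e = ± i`. -/
def circular (e p q : ℂ) : Idx → ℂ :=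
  Sum.elim 0 (Sum.elim ![p, -e * p, 0] ![q, -e * q])

/-- As `e² = -1`, the vector `(1, -e)` is an eigenvector of `w ↦ w̄^⊥` with eigenvalue `e`, so each
pair of horizontal equations collapses to one scalar equation. -/
lemma isMode_circular (P : Params) {w e p q : ℂ} (he : e ^ 2 = -1)
    (h1 : P.lam * (w * p) = -2 * P.kappa * p - (P.lam - P.nu) * P.rot * (e * p)
      - P.rot ^ 2 * (e * q))
    (h2 : w * q = (P.lam - P.nu) * (e * p) + P.rot * (e * q)) :
    IsMode P 0 w (circular e p q) := by
  constructor <;> simp [circular]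
  · linear_combination h1
  · linear_combination -e * h1 + ((P.lam - P.nu) * P.rot * p + P.rot ^ 2 * q) * he
  · linear_combination h2
  · linear_combination -e * h2 - ((P.lam - P.nu) * p + P.rot * q) * he

/-- At `k = 0` the system commutes with horizontal rotations, so both circular components of a mode
(`e = ±i`) satisfy the mode equations. They cannot both vanish, since `u` and `ω₃` are zero in a
growing mode. -/
lemma IsMode.exists_circular {P : Params} {w : ℂ} {y : Idx → ℂ} (hy : IsMode P 0 w y)
    (hy0 : y ≠ 0) (hkappa : 0 < P.kappa) (hnu : 0 < P.nu) (hw : 0 < w.re) :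
    ∃ e p q : ℂ, e ^ 2 = -1 ∧ IsMode P 0 w (circular e p q) ∧ circular e p q ≠ 0 := by
  have hw0 : w ≠ 0 := fun h => by simp [h] at hw
  obtain ⟨hd, e0, e1, e2, f0, f1, f2, b0, b1⟩ := hy
  simp [hw0] at e0 e1 e2 f0 f1 f2
  have hmode : ∀ e : ℂ, e ^ 2 = -1 → IsMode P 0 w (circular e
      (y (.inr (.inl 0)) + e * y (.inr (.inl 1))) (y (.inr (.inr 0)) + e * y (.inr (.inr 1)))) := by
    intro e he
    refine isMode_circular P he ?_ ?_
    · linear_combination f0 + e * f1 + ((P.lam - P.nu) * P.rot * y (.inr (.inl 1))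
        + P.rot ^ 2 * y (.inr (.inr 1))) * he
    · linear_combination b0 + e * b1 - ((P.lam - P.nu) * y (.inr (.inl 1))
        + P.rot * y (.inr (.inr 1))) * he
  have h2 : y (.inr (.inl 2)) = 0 := by
    -- Its real part `ν Re w + 2κ` is positive.
    have hne : (P.nu * w + 2 * P.kappa : ℂ) ≠ 0 := fun h => by
      have := congrArg Complex.re h
      simp at this
      nlinarith [mul_pos hnu hw]
    refine (mul_eq_zero.mp ?_).resolve_left hne
    linear_combination f2
  have hI : Complex.I ^ 2 = -1 := Complex.I_sq
  have hI' : (-Complex.I) ^ 2 = -1 := by rw [neg_sq, hI]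
  by_contra hcon
  push Not at hcon
  have c1 := hcon _ _ _ hI (hmode _ hI)
  have c2 := hcon _ _ _ hI' (hmode _ hI')
  have p1 := congrFun c1 (.inr (.inl 0))
  have q1 := congrFun c1 (.inr (.inr 0))
  have p2 := congrFun c2 (.inr (.inl 0))
  have q2 := congrFun c2 (.inr (.inr 0))
  simp [circular] at p1 q1 p2 q2
  refine hy0 ?_
  funext i
  rcases i with i | i | i <;> fin_cases i
  · exact e0
  · exact e1
  · exact e2
  · change y (.inr (.inl 0)) = 0
    linear_combination (p1 + p2) / 2
  · change y (.inr (.inl 1)) = 0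
    linear_combination (-Complex.I / 2) * (p1 - p2) + y (.inr (.inl 1)) * hI
  · exact h2
  · change y (.inr (.inr 0)) = 0
    linear_combination (q1 + q2) / 2
  · change y (.inr (.inr 1)) = 0
    linear_combination (-Complex.I / 2) * (q1 - q2) + y (.inr (.inr 1)) * hI

/-- A quadratic polynomial whose roots have a negative product and a sum with negative real part
has a root with positive real part. -/
lemma exists_root_re_pos {l p : ℝ} {b : ℂ} (hl : 0 < l) (hp : 0 < p) (hb : 0 < b.re) :
    ∃ z : ℂ, l * z ^ 2 + b * z - p = 0 ∧ 0 < z.re := by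
  have hlc : (l : ℂ) ≠ 0 := by exact_mod_cast hl.ne'
  have hpc : (p : ℂ) ≠ 0 := by exact_mod_cast hp.ne'
  obtain ⟨s, hs⟩ := IsAlgClosed.exists_pow_nat_eq (discrim (l : ℂ) b (-p)) (n := 2) (by norm_num)
  obtain ⟨x, hx⟩ := exists_quadratic_eq_zero (a := (l : ℂ)) (b := b) (c := -p) hlc
    ⟨s, by rw [← hs, pow_two]⟩
  by_cases hx0 : 0 < x.re
  · exact ⟨x, by linear_combination hx, hx0⟩
  have hxne : x ≠ 0 := fun h => by simp [h, hpc] at hx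
  have hsum : l * (-b / l - x) = -b - l * x := by field_simp
  set z := -b / l - x with hz
  have hprod : l * (x * z) = -p := by linear_combination x * hsum - hx
  refine ⟨z, by linear_combination z * hsum - hprod, ?_⟩
  have r1 := congrArg Complex.re hsum
  have r2 := congrArg Complex.re hprod
  have r3 := congrArg Complex.im hprod
  simp at r1 r2 r3
  -- Multiplying `l x z = -p` by the conjugate of `x` shows that `Re z` and `Re x` have opposite
  -- signs or both vanish; the sum of the roots excludes the latter.
  have r4 : z.re * (l * (x.re ^ 2 + x.im ^ 2)) = -p * x.re := by
    rcases r3 with r3 | r3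
    · exact absurd r3 hl.ne'
    · linear_combination x.re * r2 + l * x.im * r3
  have hN : 0 < l * (x.re ^ 2 + x.im ^ 2) := by
    have := Complex.normSq_pos.mpr hxne
    rw [Complex.normSq_apply] at this
    exact mul_pos hl (by linarith)
  by_contra hcon
  have h1 : z.re * (l * (x.re ^ 2 + x.im ^ 2)) ≤ 0 :=
    mul_nonpos_of_nonpos_of_nonneg (not_lt.mp hcon) hN.le
  have hx1 : x.re = 0 := le_antisymm (not_lt.mp hx0) (by nlinarith)
  have hz1 : z.re = 0 := by
    exact (mul_eq_zero.mp (r4.trans (by rw [hx1, mul_zero]))).resolve_right hN.ne'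
  rw [hx1, hz1] at r1
  simp at r1
  linarith

lemma exists_growing_mode (P : Params) (hkappa : 0 < P.kappa) (hrot : 0 < P.rot)
    (hnu : 0 < P.nu) (hl : P.nu < P.lam) :
    ∃ (w : ℂ) (y : Idx → ℂ), 0 < w.re ∧ y ≠ 0 ∧ IsMode P 0 w y := by
  have hln : 0 < P.lam - P.nu := sub_pos.mpr hl
  -- With `w = z + i d` and `e = i`, the equation for `a` reads `z q = (λ-ν) i p`, solved by `p =
  -- z`, `q = (λ-ν) i`. The equation for `ω` then becomes this quadratic in `z`; the imaginary shift
  -- leaves the growth rate unchanged.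
  obtain ⟨z, hz, hz0⟩ := exists_root_re_pos (l := P.lam) (p := (P.lam - P.nu) * P.rot ^ 2)
    (b := 2 * P.kappa + P.rot * (2 * P.lam - P.nu) * Complex.I) (hnu.trans hl)
    (by positivity) (by simpa using hkappa)
  push_cast at hz
  have hI : Complex.I ^ 2 = -1 := Complex.I_sq
  refine ⟨z + P.rot * Complex.I, circular Complex.I z ((P.lam - P.nu) * Complex.I), by simpa,
    fun h => ?_, isMode_circular P hI ?_ ?_⟩
  · have := congrFun h (.inr (.inl 0))
    simp [circular] at this
    simp [this] at hz0
  · linear_combination hz + (P.lam - P.nu) * P.rot ^ 2 * hI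
  · ring

/-! ## The maximal growth rate -/

lemma exists_mode_of_mem_growthRates (P : Params) (hkappa : 0 < P.kappa) (htau : 0 < P.tau)
    (hnu : 0 < P.nu) (hl : P.nu < P.lam) {k : V3} {w : ℂ} (hw : 0 < w.re)
    (h : Module.End.HasEigenvalue (Matrix.toLin' (matM P k)) w) :
    ∃ y : Idx → ℂ, y ≠ 0 ∧ IsMode P k w y := by
  have hw0 : w ≠ 0 := fun h => by simp [h] at hw
  obtain ⟨y, hy0, hy⟩ := exists_eigenvector_symbolB P k hkappa htau hnu hl w hw0 h
  exact ⟨y, hy0, isMode_of_eigenvector P k hnu hl w hw0 y hy⟩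

lemma finite_waveVec_le (R : ℝ) : {k : Fin 3 → ℤ | waveVec k ⬝ᵥ waveVec k ≤ R}.Finite := by
  refine (Set.Finite.pi' fun _ : Fin 3 => Set.finite_Icc (-⌈R⌉) ⌈R⌉).subset fun k hk j => ?_
  have h1 : (k j : ℝ) * k j ≤ R := (Finset.single_le_sum
    (f := fun i => waveVec k i * waveVec k i)
    (fun i _ => mul_self_nonneg _) (Finset.mem_univ j)).trans hk
  have h2 : k j * k j ≤ ⌈R⌉ := by exact_mod_cast h1.trans (Int.le_ceil R)
  constructor <;> nlinarith

lemma finite_growthRates_ge (P : Params) (hmu : 0 < P.mu) (hkappa : 0 < P.kappa)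
    (halpha : 0 < P.alpha + 4 * P.beta / 3) (hgamma : 0 < P.beta + P.gamma) (htau : 0 < P.tau)
    (hnu : 0 < P.nu) (hl : P.nu < P.lam) {ε : ℝ} (hε : 0 < ε) :
    {x | x ∈ growthRates P ∧ ε ≤ x}.Finite := by
  have hrot : 0 < P.rot := div_pos htau (by positivity)
  set c := min (P.alpha + 4 * P.beta / 3) (P.beta + P.gamma) with hc
  have hc0 : 0 < c := lt_min halpha hgamma
  refine ((finite_waveVec_le (P.rot ^ 2 * (P.lam - P.nu) / (ε * c))).biUnion fun k _ =>
    (Module.End.finite_hasEigenvalue (Matrix.toLin' (matM P (waveVec k)))).image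
      Complex.re).subset ?_
  rintro x ⟨⟨k, w, hw, rfl⟩, hx⟩
  simp only [Set.mem_iUnion]
  refine ⟨k, ?_, w, hw, rfl⟩
  obtain ⟨y, hy0, hy⟩ := exists_mode_of_mem_growthRates P hkappa htau hnu hl (hε.trans_le hx) hw
  have := hy.re_le hy0 hmu hkappa halpha hgamma hrot hnu hl (hε.trans_le hx)
  rw [Set.mem_ofPred_eq, le_div_iff₀ (by positivity)]
  have h2 : ε * (c * (waveVec k ⬝ᵥ waveVec k)) ≤ w.re * (c * (waveVec k ⬝ᵥ waveVec k)) :=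
    mul_le_mul_of_nonneg_right hx (mul_nonneg hc0.le (dotProduct_self_nonneg' _))
  linarith

lemma exists_isGreatest_growthRates (P : Params) (hmu : 0 < P.mu) (hkappa : 0 < P.kappa)
    (halpha : 0 < P.alpha + 4 * P.beta / 3) (hgamma : 0 < P.beta + P.gamma) (htau : 0 < P.tau)
    (hnu : 0 < P.nu) (hl : P.nu < P.lam) : ∃ η : ℝ, 0 < η ∧ IsGreatest (growthRates P) η := by
  have hrot : 0 < P.rot := div_pos htau (by positivity)
  obtain ⟨w, y, hw, hy0, hy⟩ := exists_growing_mode P hkappa hrot hnu hl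
  have hw0 : w ≠ 0 := fun h => by simp [h] at hw
  have hmem : w.re ∈ growthRates P := ⟨0, w, by
    have h0 : waveVec 0 = 0 := by funext j; simp [waveVec]
    rw [h0]
    exact hasEigenvalue_matM P 0 hkappa htau hnu hl w hw0 y hy0 (hy.symbolB_mulVec hnu hl), rfl⟩
  -- The rate of the explicit homogeneous mode serves as the cutoff, so the finite set is nonempty.
  obtain ⟨η, ⟨h1, h2⟩, h3⟩ := Set.exists_max_image _ id
    (finite_growthRates_ge P hmu hkappa halpha hgamma htau hnu hl hw) ⟨w.re, hmem, le_rfl⟩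
  refine ⟨η, hw.trans_le h2, h1, fun x hx => ?_⟩
  rcases le_total w.re x with h | h
  · exact h3 x ⟨hx, h⟩
  · exact h.trans h2

/-- The growth rate is attained by a mode of rotation-invariant polarization. -/
lemma exists_polarized_mode (P : Params) (hkappa : 0 < P.kappa) (htau : 0 < P.tau)
    (hnu : 0 < P.nu) (hl : P.nu < P.lam) {η : ℝ} (hη : 0 < η) (h : η ∈ growthRates P) :
    ∃ (k : Fin 3 → ℤ) (w : ℂ) (y : Idx → ℂ), w.re = η ∧ y ≠ 0 ∧ IsMode P (waveVec k) w y ∧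
      (k = 0 → ∑ i, y (.inl i) ^ 2 = 0 ∧ ∑ i, y (.inr (.inl i)) ^ 2 = 0 ∧
        ∑ i, y (.inr (.inr i)) ^ 2 = 0) := by
  obtain ⟨k, w, hw, rfl⟩ := h
  obtain ⟨y, hy0, hy⟩ := exists_mode_of_mem_growthRates P hkappa htau hnu hl hη hw
  by_cases hk : k = 0
  · have h0 : waveVec k = 0 := by funext j; simp [waveVec, hk]
    rw [h0] at hy
    obtain ⟨e, p, q, he, hm, hne⟩ := hy.exists_circular hy0 hkappa hnu hη
    refine ⟨k, w, circular e p q, rfl, hne, by rwa [h0], fun _ => ?_⟩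
    simp only [circular, Sum.elim_inl, Sum.elim_inr, Fin.sum_univ_three, Fin.sum_univ_two]
    refine ⟨by simp, ?_, ?_⟩
    · simp
      linear_combination p ^ 2 * he
    · simp
      linear_combination q ^ 2 * he
  · exact ⟨k, w, y, rfl, hy0, hy, fun h => absurd h hk⟩

/-! ## The linearized operator on plane waves -/

lemma divergence_wave (k : V3) (c : Fin 3 → ℂ) :
    divergence (fun x i => wave k (c i) x) =
      wave k (Complex.I * (k 0 * c 0 + k 1 * c 1 + k 2 * c 2)) := by
  funext x
  simp only [divergence, pderiv_wave, Fin.sum_univ_three, ← wave_add]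
  congr 1; ring

lemma curl_wave (k : V3) (c : Fin 3 → ℂ) (x : V3) :
    curl (fun x i => wave k (c i) x) x =
      ![wave k (Complex.I * (k 1 * c 2 - k 2 * c 1)) x,
        wave k (Complex.I * (k 2 * c 0 - k 0 * c 2)) x,
        wave k (Complex.I * (k 0 * c 1 - k 1 * c 0)) x] := by
  simp only [curl, pderiv_wave, ← wave_sub]
  have h : ∀ a b c d : ℂ, Complex.I * a * b - Complex.I * c * d = Complex.I * (a * b - c * d) :=
    fun a b c d => by ring
  simp only [h]

lemma laplacian_wave (k : V3) (c : Fin 3 → ℂ) (x : V3) (i : Fin 3) :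
    laplacian (fun x i => wave k (c i) x) x i = wave k (-((k ⬝ᵥ k : ℝ) * c i)) x := by
  simp only [laplacian, pderiv_wave, Fin.sum_univ_three, ← wave_add]
  congr 1
  simp only [dotProduct, Fin.sum_univ_three]
  push_cast
  linear_combination ((k 0) ^ 2 + (k 1) ^ 2 + (k 2) ^ 2 : ℂ) * c i * Complex.I_sq

lemma gradient_wave (k : V3) (c : ℂ) (x : V3) (j : Fin 3) :
    gradient (wave k c) x j = wave k (Complex.I * k j * c) x := by
  simp only [gradient, pderiv_wave]

/-- The Leray projector fixes a divergence-free wave, so every operator left acts on amplitudes, and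
the mode equations apply componentwise. -/
lemma IsMode.opB_wave {P : Params} {k : Fin 3 → ℤ} {w : ℂ} {y : Idx → ℂ}
    (hy : IsMode P (waveVec k) w y) (hn : 0 < P.nu) (hl : P.nu < P.lam) (x : V3) (i : Idx) :
    opB P (fun x i => wave (waveVec k) (y i) x) x i = wave (waveVec k) (w * y i) x := by
  have hlam : P.lam ≠ 0 := (hn.trans hl).ne'
  have hleray := leray_wave k (fun i => y (.inl i)) (by
    rw [Fin.sum_univ_three]; exact hy.div_free)
  obtain ⟨hd, e0, e1, e2, f0, f1, f2, b0, b1⟩ := hy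
  have hu : uPart (fun x i => wave (waveVec k) (y i) x) =
    fun x i => wave (waveVec k) (y (.inl i)) x := rfl
  have hom : omegaPart (fun x i => wave (waveVec k) (y i) x) =
    fun x i => wave (waveVec k) (y (.inr (.inl i))) x := rfl
  have ha : aPart (fun x i => wave (waveVec k) (y i) x) =
    fun x i => wave (waveVec k) (y (.inr (.inr i))) x := rfl
  rw [opB, hu, hleray, hom, ha]
  set K := waveVec k
  have hI := Complex.I_sq
  have fold : ∀ {A B : ℂ}, A = B → wave K A x = wave K B x := fun h => by rw [h]
  rcases i with i | i | i <;> fin_cases i <;>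
    simp only [opM, diagD, Params.inertia, divergence_wave, curl_wave, perpTilde, perpBar,
      Sum.elim_inl, Sum.elim_inr, Pi.add_apply, Pi.sub_apply, Pi.smul_apply, laplacian_wave,
      gradient_wave, smul_eq_mul, Fin.zero_eta, Fin.mk_one, Fin.reduceFinMk,
      Matrix.cons_val_zero, Matrix.cons_val_one, Matrix.cons_val, inv_one, one_mul, mul_zero,
      sub_zero]
  · rw [← wave_real_mul, ← wave_real_mul, ← wave_add]
    refine fold ?_
    push_cast
    linear_combination -e0
  · rw [← wave_real_mul, ← wave_real_mul, ← wave_add]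
    refine fold ?_
    push_cast
    linear_combination -e1
  · rw [← wave_real_mul, ← wave_real_mul, ← wave_add]
    refine fold ?_
    push_cast
    linear_combination -e2
  · rw [inv_mul_eq_iff_eq_mul₀ hlam]
    simp only [← wave_neg, ← wave_real_mul, ← wave_add, ← wave_sub]
    refine fold ?_
    push_cast
    linear_combination -f0 + (P.alpha + P.beta / 3 - P.gamma) * K 0 * (K 0 * y (.inr (.inl 0)) +
      K 1 * y (.inr (.inl 1)) + K 2 * y (.inr (.inl 2))) * hI
  · rw [inv_mul_eq_iff_eq_mul₀ hlam]
    simp only [← wave_real_mul, ← wave_add, ← wave_sub]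
    refine fold ?_
    push_cast
    linear_combination -f1 + (P.alpha + P.beta / 3 - P.gamma) * K 1 * (K 0 * y (.inr (.inl 0)) +
      K 1 * y (.inr (.inl 1)) + K 2 * y (.inr (.inl 2))) * hI
  · rw [inv_mul_eq_iff_eq_mul₀ hn.ne']
    simp only [← wave_real_mul, ← wave_add, ← wave_sub]
    refine fold ?_
    push_cast
    linear_combination -f2 + (P.alpha + P.beta / 3 - P.gamma) * K 2 * (K 0 * y (.inr (.inl 0)) +
      K 1 * y (.inr (.inl 1)) + K 2 * y (.inr (.inl 2))) * hI
  · simp only [← wave_neg, ← wave_real_mul, ← wave_add]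
    refine fold ?_
    push_cast
    linear_combination -b0
  · simp only [← wave_real_mul, ← wave_add]
    refine fold ?_
    push_cast
    linear_combination -b1

lemma hasDerivAt_wave_exp (k : V3) (w c : ℂ) (x : V3) (t : ℝ) :
    HasDerivAt (fun s : ℝ => wave k (Complex.exp (w * s) * c) x)
      (wave k (w * (Complex.exp (w * t) * c)) x) t := by
  have h := (((Complex.ofRealCLM.hasDerivAt (x := t)).const_mul w).cexp.mul_const c).mul_const
    (character k x)
  refine (Complex.reCLM.hasFDerivAt.comp_hasDerivAt t h).congr_deriv ?_
  simp only [Complex.reCLM_apply, wave, Complex.ofRealCLM_apply, Complex.ofReal_one]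
  congr 1
  ring

lemma contDiff_wave_exp (k : V3) (w c : ℂ) :
    ContDiff ℝ ∞ (fun p : ℝ × V3 => wave k (Complex.exp (w * p.1) * c) p.2) := by
  have h : ContDiff ℝ ∞ fun p : ℝ × V3 => Complex.exp (w * (Complex.ofRealCLM p.1)) := by fun_prop
  exact Complex.reCLM.contDiff.comp
    ((h.mul contDiff_const).mul ((contDiff_character k).comp contDiff_snd))

end Micropolar

end

theorem mainTheorem9 (P : Micropolar.Params)
    (hmu : 0 < P.mu) (hkappa : 0 < P.kappa)
    (halpha : 0 < P.alpha + 4 * P.beta / 3) (hgamma : 0 < P.beta + P.gamma)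
    (htau : 0 < P.tau) (hnu : 0 < P.nu) (hoblong : P.nu < P.lam) :
    ∃ η : ℝ, 0 < η ∧ IsGreatest (Micropolar.growthRates P) η ∧
      ∃ Y : ℝ → Micropolar.V3 → Micropolar.Idx → ℝ,
        ContDiffOn ℝ ∞ (fun p : ℝ × Micropolar.V3 => Y p.1 p.2) (Set.Ici 0 ×ˢ Set.univ) ∧
        (∀ t : ℝ, 0 ≤ t → Micropolar.IsPeriodic (Y t)) ∧
        (∀ t : ℝ, 0 ≤ t → ∀ x : Micropolar.V3,
          HasDerivWithinAt (fun s => Y s x) (Micropolar.opB P (Y t) x) (Set.Ici 0) t) ∧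
        (∀ t : ℝ, 0 ≤ t → ∀ x : Micropolar.V3,
          Micropolar.divergence (Micropolar.uPart (Y t)) x = 0) ∧
        Y 0 ≠ 0 ∧
        ∀ r : ℝ, 0 ≤ r → ∀ t : ℝ, 0 ≤ t →
          Micropolar.SobolevFinite r (Y t) ∧
          Micropolar.sobolevNorm r (Y t) =
            Real.exp (η * t) * Micropolar.sobolevNorm r (Y 0) ∧
          Micropolar.sobolevNorm r (Micropolar.uPart (Y t)) =
            Real.exp (η * t) * Micropolar.sobolevNorm r (Micropolar.uPart (Y 0)) ∧
          Micropolar.sobolevNorm r (Micropolar.omegaPart (Y t)) =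
            Real.exp (η * t) * Micropolar.sobolevNorm r (Micropolar.omegaPart (Y 0)) ∧
          Micropolar.sobolevNorm r (Micropolar.aPart (Y t)) =
            Real.exp (η * t) * Micropolar.sobolevNorm r (Micropolar.aPart (Y 0)) := by
  obtain ⟨η, hη, hmax⟩ := Micropolar.exists_isGreatest_growthRates P hmu hkappa halpha hgamma htau
    hnu hoblong
  obtain ⟨k, w, y, rfl, hy0, hy, hpol⟩ := Micropolar.exists_polarized_mode P hkappa htau hnu
    hoblong hη hmax.1
  have hall : k = 0 → ∑ i, y i ^ 2 = 0 := fun h => by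
    obtain ⟨h1, h2, h3⟩ := hpol h
    rw [Fintype.sum_sum_type, Fintype.sum_sum_type, h1, h2, h3, add_zero, add_zero]
  have hexp : ∀ t : ℝ, ‖Complex.exp (w * t)‖ = Real.exp (w.re * t) := fun t => by
    rw [Complex.norm_exp, Complex.re_mul_ofReal]
  have hnorm : ∀ {ι : Type} [Fintype ι] (c : ι → ℂ), (k = 0 → ∑ i, c i ^ 2 = 0) →
      ∀ r t : ℝ, Micropolar.sobolevNorm r
        (fun x i => Micropolar.wave (Micropolar.waveVec k) (Complex.exp (w * t) * c i) x) =
      Real.exp (w.re * t) * Micropolar.sobolevNorm r (fun x i =>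
        Micropolar.wave (Micropolar.waveVec k) (Complex.exp (w * (0 : ℝ)) * c i) x) := by
    intro ι _ c hc r t
    rw [Micropolar.sobolevNorm_wave k c hc, hexp]
    simp only [Complex.ofReal_zero, mul_zero, Complex.exp_zero, one_mul]
  -- Since `w` may be non-real, the factor `e^{wt}` also turns the phase; only its modulus `e^{ηt}`
  -- is seen by the norms.
  refine ⟨w.re, hη, hmax, fun t x i =>
    Micropolar.wave (Micropolar.waveVec k) (Complex.exp (w * t) * y i) x, ?_, ?_, ?_, ?_, ?_, ?_⟩
  · exact (contDiff_pi.mpr fun i => Micropolar.contDiff_wave_exp _ w (y i)).contDiffOn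
  · intro t _ x j
    funext i
    exact Micropolar.isPeriodic_wave k _ x j
  · intro t _ x
    refine HasDerivAt.hasDerivWithinAt (hasDerivAt_pi.mpr fun i => ?_)
    rw [(hy.smul (Complex.exp (w * t))).opB_wave hnu hoblong x i]
    exact Micropolar.hasDerivAt_wave_exp _ w (y i) x t
  · intro t _ x
    have h := Micropolar.divergence_wave (Micropolar.waveVec k)
      fun i => Complex.exp (w * t) * y (.inl i)
    rw [(hy.smul (Complex.exp (w * t))).div_free, mul_zero] at h
    exact (congrFun h x).trans (Micropolar.wave_zero _ x)
  · intro h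
    refine hy0 (Micropolar.eq_zero_of_wave_eq_zero k y hall fun x i => ?_)
    simpa using congrFun (congrFun h x) i
  · intro r _ t _
    exact ⟨Micropolar.sobolevFinite_wave k _ r, hnorm y hall r t,
      hnorm (fun i => y (.inl i)) (fun h => (hpol h).1) r t,
      hnorm (fun i => y (.inr (.inl i))) (fun h => (hpol h).2.1) r t,
      hnorm (fun i => y (.inr (.inr i))) (fun h => (hpol h).2.2) r t⟩
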